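/- Let $n\ge 7$ be an integer all of whose prime factors are congruent to $1$ modulo $6$, and let $a$ be a solution of $x^2-x+1\equiv 0 \pmod n$. Let $\Gamma=TL_n(a,a-1,1)=\mathrm{Cay}(\mathbb Z_n,\{\pm[1],\pm[a],\pm[a-1]\})$ (a 6-valent first-kind Frobenius circulant), let $D$ be its diameter, $d(\cdot,\cdot)$ its distance, and $H=\langle[a]\rangle=\{\pm[1],\pm[a],\pm[a-1]\}\le\mathbb Z_n^*$; the group $\mathbb Z_n\rtimes H$ acts on $\mathbb Z_n$ by $x\mapsto (x+y)h$ ($y\in\mathbb Z_n$, $h\in H$). **Notions.** A routing is a choice of one oriented path for each ordered pair of vertices. The load of an edge (arc) is the number of times it is traversed by these paths in either direction (in the direction of the arc). The forwarding indices $\pi$ and $\overrightarrow{\pi}$ are the minima over all routings of the maximum edge load and of the maximum arc load; $\pi_m$ and $\overrightarrow{\pi}_m$ are the same minima over shortest path routings only. A routing is edge- (arc-) uniform if all edges (arcs) have the same load, and it is $G$-arc-transitive, for a group $G$ of automorphisms, if $G$ maps paths of the routing to paths of the routing and is transitive on arcs. In gossiping every vertex has a message to be sent to all others, in the store-and-forward,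 all-port, full-duplex model: in one time step each arc carries at most one message, and a vertex can only send messages that it held before the step; $t(\Gamma)$ is the minimum number of time steps. For $0\neq\alpha\in\mathbb Z[\rho]$, $\rho=(1+\sqrt{-3})/2$, the graph $EJ_\alpha$ is the Cayley graph on $\mathbb Z[\rho]/(\alpha)$ with connection set $\{\pm1,\pm\rho,\pm\rho^2\}$. **Construction.** Put the orbit $H[1]$ into $X$, with cell $(1,0)$. For $\ell=2,3,\dots$, until all of $\mathbb Z_n\setminus\{[0]\}$ is contained in $X$, examine the cells $(\ell,0),(\ell-1,1),\dots,(1,\ell-1)$ in this order; when examining $(i,j)$, add the orbit $H[i+ja]$ to $X$ (with cell $(i,j)$) if it is not yet contained in $X$. Let $Y$ be the set of the elements $[i+ja]$ over all the cells $(i,j)$ that were added. For $t\ge1$ let $Y_t=\{v\in Y: d([0],v)=t\}$ and $n_t=|Y_t|$. For each $v\in Y_{t+1}$ choose a neighbour $p(v)$ of $v$ at distance $t$ from $[0]$ with $p(v)\in Y$ (with $p(v)=[0]$ if $t=0$), and put $A(v)=\{(p(v)a^k,\,va^k):0\le k\le5\}$. Let $T_0$ be the graph on $\mathbb Z_n$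 with arcs $\bigcup_{v\in Y}A(v)$, let $T_u$ be its translate by $u$, and let $P_{uv}$ be the path in $T_u$ from $u$ to $v$ and $\mathcal P=\{P_{uv}\}$. Algorithm: enumerate each $Y_t$ as $v_{t,1},\dots,v_{t,n_t}$ in any way; there are phases $t=1,\dots,D$, phase $t$ has $n_t$ time steps, and in its $l$-th step, for every $w\in\mathbb Z_n$ simultaneously, the message of $w$ is transmitted along the six arcs of $A(v_{t,l})+w$. **Conclusions.** 1. $\pi(\Gamma)=2\overrightarrow{\pi}(\Gamma)=2\overrightarrow{\pi}_m(\Gamma)=\pi_m(\Gamma)$. There are integers $c\ge d\ge0$ with $\gcd(c,d)=1$ and $\Gamma\cong EJ_{c+d\rho}$, and for all integers $c\ge d\ge 0$ with $\Gamma\cong EJ_{c+d\rho}$ the common value is $$D(D+1)\big[(2c+d)-(2D+1)\big]-\tfrac1{12}(2c-d)\big[(c+d)^2-1\big]\quad\text{if } c+d \text{ is odd},$$ $$\tfrac12D(D+1)\big[(7c+5d)-2(2D+1)\big]+\tfrac1{12}(c+d)^2(4c+d-6)+\tfrac16(c+d)\big[n-3c+3-6D(2c+d)\big]\quad\text{if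 } c+d\text{ is even}.$$ 2. $t(\Gamma)=(n-1)/6$. 3. The choice of $p$ is possible. For every choice of $p$, the graphs $T_u$ are spanning trees of $\Gamma$ (so that $\mathcal P$ is well defined), and $\mathcal P$ is a shortest path routing that is $\mathbb Z_n\rtimes H$-arc-transitive, edge-uniform and arc-uniform, and attains $\pi$, $\overrightarrow{\pi}$, $\overrightarrow{\pi}_m$ and $\pi_m$ simultaneously. 4. For every choice of $p$ and of the enumerations, the algorithm is a gossiping scheme for $\Gamma$ with exactly $t(\Gamma)$ time steps, such that: (a) the message of any vertex is transmitted along shortest paths to all other vertices (and every transmission of it increases the distance from its origin by one); (b) for each vertex $w$, in every time step $1,\dots,t(\Gamma)$ precisely six arcs carry the message of $w$, and in every time step $\ge2$ these six arcs form a matching; (c) in every time step each arc of $\Gamma$ is used for exactly one message. -/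

import Mathlib

namespace FrobeniusCirculant

open SimpleGraph

section General

variable {V : Type*}

/-! ### Routings and forwarding indices -/

/-- A routing: one oriented path for each ordered pair of vertices
(the path from a vertex to itself is trivial and traverses nothing). -/
abbrev Routing (G : SimpleGraph V) : Type _ := ∀ u v : V, G.Path u v

/-- The number of times an edge is traversed, in either direction, by the paths of a routing. -/
def edgeLoad [Fintype V] [DecidableEq V] {G : SimpleGraph V} (R : Routing G) (e : Sym2 V) : ℕ :=
  ∑ u, ∑ v, (R u v).1.edges.count e

/-- The number of times an arc is traversed, in its own direction, by the paths of a routing. -/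
def arcLoad [Fintype V] [DecidableEq V] {G : SimpleGraph V} (R : Routing G) (d : G.Dart) : ℕ :=
  ∑ u, ∑ v, (R u v).1.darts.count d

/-- The maximum load on an edge. -/
noncomputable def maxEdgeLoad [Fintype V] [DecidableEq V] {G : SimpleGraph V}
    (R : Routing G) : ℕ :=
  ⨆ e : G.edgeSet, edgeLoad R e

/-- The maximum load on an arc. -/
noncomputable def maxArcLoad [Fintype V] [DecidableEq V] {G : SimpleGraph V}
    (R : Routing G) : ℕ :=
  ⨆ d : G.Dart, arcLoad R d

/-- All paths of the routing are shortest paths. -/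
def IsShortestPathRouting {G : SimpleGraph V} (R : Routing G) : Prop :=
  ∀ u v, (R u v).1.length = G.dist u v

/-- The edge-forwarding index `π`. -/
noncomputable def edgeForwardingIndex [Fintype V] [DecidableEq V] (G : SimpleGraph V) : ℕ :=
  ⨅ R : Routing G, maxEdgeLoad R

/-- The arc-forwarding index. -/
noncomputable def arcForwardingIndex [Fintype V] [DecidableEq V] (G : SimpleGraph V) : ℕ :=
  ⨅ R : Routing G, maxArcLoad R

/-- The minimal edge-forwarding index `π_m`. -/
noncomputable def minimalEdgeForwardingIndex [Fintype V] [DecidableEq V]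
    (G : SimpleGraph V) : ℕ :=
  ⨅ R : {R : Routing G // IsShortestPathRouting R}, maxEdgeLoad R.1

/-- The minimal arc-forwarding index. -/
noncomputable def minimalArcForwardingIndex [Fintype V] [DecidableEq V]
    (G : SimpleGraph V) : ℕ :=
  ⨅ R : {R : Routing G // IsShortestPathRouting R}, maxArcLoad R.1

/-- All edges have the same load. -/
def IsEdgeUniform [Fintype V] [DecidableEq V] {G : SimpleGraph V} (R : Routing G) : Prop :=
  ∀ e ∈ G.edgeSet, ∀ f ∈ G.edgeSet, edgeLoad R e = edgeLoad R f

/-- All arcs have the same load. -/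
def IsArcUniform [Fintype V] [DecidableEq V] {G : SimpleGraph V} (R : Routing G) : Prop :=
  ∀ d d' : G.Dart, arcLoad R d = arcLoad R d'

/-- A routing is `A`-arc-transitive: `A` is a group of automorphisms of `G`, it maps paths of the
routing to paths of the routing, and it is transitive on the arcs of `G`.
(A walk of a simple graph is determined by its sequence of vertices.) -/
def IsArcTransitiveRouting {G : SimpleGraph V} (A : Subgroup (Equiv.Perm V))
    (R : Routing G) : Prop :=
  (∀ g ∈ A, ∀ x y, G.Adj (g x) (g y) ↔ G.Adj x y) ∧
  (∀ g ∈ A, ∀ u v, (R u v).1.support.map g = (R (g u) (g v)).1.support) ∧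
  (∀ x y x' y', G.Adj x y → G.Adj x' y' → ∃ g ∈ A, g x = x' ∧ g y = y')

/-! ### Gossiping in the store-and-forward, all-port, full-duplex model

`send s w x y` means: in time step `s = 1, 2, …` the message originating at `w` is transmitted
over the arc from `x` to `y`. -/

/-- `Knows send s x` is the set of (the origins of) the messages held by `x` after step `s`. -/
def Knows (send : ℕ → V → V → V → Prop) : ℕ → V → Set V
  | 0, x => {x}
  | s + 1, x => Knows send s x ∪ {w | ∃ y, send (s + 1) w y x}

/-- `send` is a gossiping scheme on `G` with `T` time steps. -/
structure IsGossipScheme (G : SimpleGraph V) (T : ℕ) (send : ℕ → V → V → V → Prop) : Prop where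
  time : ∀ s w x y, send s w x y → 1 ≤ s ∧ s ≤ T
  adj : ∀ s w x y, send s w x y → G.Adj x y
  one_message : ∀ s w w' x y, send s w x y → send s w' x y → w = w'
  store_forward : ∀ s w x y, send (s + 1) w x y → w ∈ Knows send s x
  complete : ∀ w x, w ∈ Knows send T x

/-- The minimum gossip time. -/
noncomputable def gossipTime (G : SimpleGraph V) : ℕ :=
  sInf {T | ∃ send, IsGossipScheme G T send}

/-- The arcs carrying the message of `w` at time `s`. -/
def arcsUsed (send : ℕ → V → V → V → Prop) (s : ℕ) (w : V) : Set (V × V) :=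
  {e | send s w e.1 e.2}

/-- No two distinct members of a set of arcs share an end-vertex. -/
def IsArcMatching (M : Set (V × V)) : Prop :=
  ∀ e ∈ M, ∀ f ∈ M, e ≠ f → e.1 ≠ f.1 ∧ e.1 ≠ f.2 ∧ e.2 ≠ f.1 ∧ e.2 ≠ f.2

/-- The message of `w` reaches `v` along a shortest path, step after step. -/
def ReachesAlongShortestPath (G : SimpleGraph V) (send : ℕ → V → V → V → Prop) (w v : V) : Prop :=
  ∃ q : G.Walk w v, q.length = G.dist w v ∧
    ∃ τ : ℕ → ℕ, StrictMonoOn τ (Set.Iio q.length) ∧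
      ∀ i < q.length, send (τ i) w (q.getVert i) (q.getVert (i + 1))

end General

/-! ### Eisenstein–Jacobi graphs -/

/-- The Eisenstein–Jacobi integers `ℤ[ρ]`, `ρ² = -1 + ρ`; `⟨x, y⟩` is `x + yρ`. -/
abbrev EJInt : Type := QuadraticAlgebra ℤ (-1) 1

/-- The unit `ρ = (1 + √-3) / 2`. -/
def rho : EJInt := ⟨0, 1⟩

/-- The Eisenstein–Jacobi graph of `α`: the Cayley graph on `ℤ[ρ]/(α)` with connection set
`{±1, ±ρ, ±ρ²}`. -/
def EJGraph (α : EJInt) : SimpleGraph (EJInt ⧸ Ideal.span {α}) :=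
  circulantGraph ((Ideal.Quotient.mk (Ideal.span {α})) '' {1, -1, rho, -rho, rho ^ 2, -rho ^ 2})

/-! ### The circulants and the groups `H` and `ℤ_n ⋊ H` -/

/-- `TL_n(a, b, c)`: the Cayley graph on `ℤ_n` with connection set `{±a, ±b, ±c}`. -/
def TL {n : ℕ} (a b c : ZMod n) : SimpleGraph (ZMod n) :=
  circulantGraph {a, -a, b, -b, c, -c}

/-- `TL_n(a, a - 1, 1)`. -/
abbrev frobGraph {n : ℕ} (a : ZMod n) : SimpleGraph (ZMod n) := TL a (a - 1) 1

/-- A solution of `a² - a + 1 = 0` as a unit of `ℤ_n`. -/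
def solUnit {n : ℕ} (a : ZMod n) (ha : a ^ 2 - a + 1 = 0) : (ZMod n)ˣ where
  val := a
  inv := 1 - a
  val_inv := by linear_combination -ha
  inv_val := by linear_combination -ha

/-- The subgroup `H = ⟨a⟩` of `ℤ_n^*`. -/
def complementH {n : ℕ} (a : ZMod n) (ha : a ^ 2 - a + 1 = 0) : Subgroup (ZMod n)ˣ :=
  Subgroup.zpowers (solUnit a ha)

/-- `ℤ_n ⋊ H` as a permutation group on `ℤ_n`; the pair `(y, h)` acts as `x ↦ (x + y) h`. -/
def affineGroup {n : ℕ} (a : ZMod n) (ha : a ^ 2 - a + 1 = 0) :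
    Subgroup (Equiv.Perm (ZMod n)) where
  carrier := {g | ∃ y : ZMod n, ∃ h ∈ complementH a ha, ∀ x, g x = (x + y) * (h : ZMod n)}
  one_mem' := ⟨0, 1, one_mem _, fun x => by simp⟩
  mul_mem' := by
    rintro g g' ⟨y, h, hh, hg⟩ ⟨y', h', hh', hg'⟩
    refine ⟨y' + y * ((h'⁻¹ : (ZMod n)ˣ) : ZMod n), h' * h, mul_mem hh' hh, fun x => ?_⟩
    have e : (h' : ZMod n) * ((h'⁻¹ : (ZMod n)ˣ) : ZMod n) = 1 := by simp
    rw [Equiv.Perm.mul_apply, hg, hg', Units.val_mul]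
    linear_combination (-y * (h : ZMod n)) * e
  inv_mem' := by
    rintro g ⟨y, h, hh, hg⟩
    refine ⟨-(y * (h : ZMod n)), h⁻¹, inv_mem hh, fun x => ?_⟩
    have e : ((h⁻¹ : (ZMod n)ˣ) : ZMod n) * (h : ZMod n) = 1 := by simp
    rw [Equiv.Perm.inv_eq_iff_eq, hg]
    linear_combination (-x + y * (h : ZMod n)) * e

/-! ### The minimum distance diagram

A cell `(i, j)` of the first sector of the hexagonal lattice carries the label `i + ja`; the cell
`(i, j, k)` carries the label `(i + ja) a^k`. The state of the algorithm is the set of the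
first-sector cells put into the diagram so far; with each cell its whole `H`-orbit is put in. -/

/-- The label of the cell `(i, j, 0)`. -/
def cellLabel {n : ℕ} (a : ZMod n) (p : ℕ × ℕ) : ZMod n := p.1 + p.2 * a

/-- The orbit `H x` with `H = ⟨a⟩`. -/
def orbitH {n : ℕ} (a x : ZMod n) : Set (ZMod n) := {y | ∃ k : ℕ, y = a ^ k * x}

/-- The elements of `ℤ_n` covered by the orbits of the given cells. -/
def covered {n : ℕ} (a : ZMod n) (C : Set (ℕ × ℕ)) : Set (ZMod n) :=
  ⋃ p ∈ C, orbitH a (cellLabel a p)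

open Classical in
/-- Examine one cell. -/
noncomputable def examine {n : ℕ} (a : ZMod n) (C : Set (ℕ × ℕ)) (p : ℕ × ℕ) : Set (ℕ × ℕ) :=
  if orbitH a (cellLabel a p) ⊆ covered a C then C else insert p C

/-- Examine the cells `(ℓ, 0), (ℓ - 1, 1), …, (1, ℓ - 1)` in this order. -/
noncomputable def examineLevel {n : ℕ} (a : ZMod n) (C : Set (ℕ × ℕ)) (l : ℕ) : Set (ℕ × ℕ) :=
  ((List.range l).map fun j => (l - j, j)).foldl (examine a) C

open Classical in
/-- The state of the algorithm after level `m + 1`. It stops when all nonzero elements are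
covered. -/
noncomputable def diagramCells {n : ℕ} (a : ZMod n) : ℕ → Set (ℕ × ℕ)
  | 0 => {(1, 0)}
  | m + 1 =>
    if ({0}ᶜ : Set (ZMod n)) ⊆ covered a (diagramCells a m) then diagramCells a m
    else examineLevel a (diagramCells a m) (m + 2)

/-- The first sector `Y` of the final diagram, as a set of elements of `ℤ_n`. -/
def sectorY {n : ℕ} (a : ZMod n) : Set (ZMod n) :=
  cellLabel a '' ⋃ m, diagramCells a m

/-- `Γ_t[0] ∩ Y`. -/
def layer {n : ℕ} (a : ZMod n) (t : ℕ) : Set (ZMod n) :=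
  {v | v ∈ sectorY a ∧ (frobGraph a).dist 0 v = t}

/-- `n_t = |Γ_t[0] ∩ Y|`. -/
noncomputable def layerCard {n : ℕ} (a : ZMod n) (t : ℕ) : ℕ := (layer a t).ncard

/-! ### The rotated shortest path spanning trees, the routing and the gossiping algorithm -/

/-- `p` chooses, for each `v ∈ Y` at distance `t + 1` from `0`, a neighbour at distance `t`
from `0` in `Y` (and the root `0` if `t = 0`). -/
def IsParentChoice {n : ℕ} (a : ZMod n) (p : ZMod n → ZMod n) : Prop :=
  ∀ v ∈ sectorY a, p v ∈ insert 0 (sectorY a) ∧ (frobGraph a).Adj (p v) v ∧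
    (frobGraph a).dist 0 (p v) + 1 = (frobGraph a).dist 0 v

/-- The arcs `(p(v) a^k, v a^k)`, `0 ≤ k ≤ 5`. -/
def rotatedArcs {n : ℕ} (a : ZMod n) (p : ZMod n → ZMod n) (v : ZMod n) :
    Set (ZMod n × ZMod n) :=
  {e | ∃ k : ℕ, k ≤ 5 ∧ e = (p v * a ^ k, v * a ^ k)}

/-- The graph `T_u`, the translate by `u` of the graph `T_0` whose arcs are all the arcs
`(p(v) a^k, v a^k)`, `v ∈ Y`. -/
def treeT {n : ℕ} (a : ZMod n) (p : ZMod n → ZMod n) (u : ZMod n) : SimpleGraph (ZMod n) :=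
  SimpleGraph.fromRel fun x y => ∃ v ∈ sectorY a, (x - u, y - u) ∈ rotatedArcs a p v

/-- For all `u, v`, the path from `u` to `v` is a path in `T_u`. -/
def IsTreeRouting {n : ℕ} (a : ZMod n) (p : ZMod n → ZMod n) (P : Routing (frobGraph a)) : Prop :=
  ∀ u v, ∀ e ∈ (P u v).1.edges, e ∈ (treeT a p u).edgeSet

/-- The gossiping algorithm. Given enumerations `v_{t,1}, v_{t,2}, …, v_{t,n_t}` of the sets
`Γ_t[0] ∩ Y`, phase `t = 1, …, D` has `n_t` steps, and in its `l`-th step each message `M_w` is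
transmitted along the six arcs `A_{t,l} + w`. (`ord t` is indexed from `0`.) -/
def algorithmSend {n : ℕ} (a : ZMod n) (p : ZMod n → ZMod n)
    (ord : ∀ t, Fin (layerCard a t) ≃ layer a t) : ℕ → ZMod n → ZMod n → ZMod n → Prop :=
  fun s w x y => ∃ t : ℕ, 1 ≤ t ∧ t ≤ (frobGraph a).diam ∧ ∃ l : Fin (layerCard a t),
    s = ∑ i ∈ Finset.Ico 1 t, layerCard a i + (l + 1) ∧
      (x - w, y - w) ∈ rotatedArcs a p (ord t l)

end FrobeniusCirculant

open FrobeniusCirculant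

namespace FrobeniusCirculant

open SimpleGraph

/-! Evaluation `ρ ↦ a` maps `ℤ[ρ]` onto `ℤ_n`, taking the six units to the connection set and
multiplication by `ρ` to multiplication by `a`. So the circulant is a quotient of the triangular
lattice (`frobGraph_eq_hexCayley`), and a distance in it is the least hexagonal norm in a coset of
the kernel (`exists_hexNorm_eq_dist`). As `ℤ[ρ]` is Euclidean, the kernel is generated by one
element of norm `n`; up to units and conjugation it is `c + dρ` with `c ≥ d ≥ 0`.

Forwarding: the arc loads of any routing add up to at least the sum of all distances, so a shortest
path routing that loads all arcs equally attains all four indices (`forwarding_indices`). The tree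
routing has this property by symmetry: each group element takes `T_u` to the tree at the image of
`u`, and paths in trees are unique. Hence `3π = ∑ d(0, x)`. This sum is found by counting vertices
farther than `t`: for `2t < c + d` the ball is an embedded hexagon (`ncard_dist_le`), and for larger
`t` the far vertices form two opposite triangles (`ncard_lt_dist`).

The diagram: the greedy procedure keeps the earliest cell of each nonzero `H`-orbit, so `Y` is a
transversal. The delicate point is that `Y` is closed under some predecessor map
(`exists_parent_cell`): a missing predecessor would produce a nonzero kernel element of norm at most
the diameter `D`, which is impossible because `D² < n` (`diam_sq_lt`). Coprimality of `n` to 6 makes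
every nonzero orbit have six elements, whence `|Y| = (n - 1) / 6`.

Gossiping: a vertex must receive `n - 1` messages over six incoming arcs, which bounds the time from
below. In the algorithm each step serves one orbit; the six arcs of `A(v)` point in the six
different directions, so their translates by all `w` use each arc exactly once. The steps respect
distance from the origin, so every message is on hand when it must be forwarded. -/

/-! ### The hexagonal norm on the Eisenstein–Jacobi integers -/

/-- The word length of `z` with respect to the units of `ℤ[ρ]`. -/
def hexNorm (z : EJInt) : ℕ := max z.re.natAbs (max z.im.natAbs (z.re + z.im).natAbs)

theorem rho_mul (z : EJInt) : rho * z = ⟨-z.im, z.re + z.im⟩ := by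
  ext <;> simp [rho]

theorem rho_sq : rho ^ 2 = (⟨-1, 1⟩ : EJInt) := by
  rw [pow_two, rho_mul]; simp [rho]

theorem rho_cube : rho ^ 3 = (-1 : EJInt) := by
  rw [pow_succ', rho_sq, rho_mul]; rfl

theorem rho_pow_six : rho ^ 6 = (1 : EJInt) := by
  rw [show 6 = 3 * 2 from rfl, pow_mul, rho_cube]; norm_num

theorem hexNorm_rho_mul (z : EJInt) : hexNorm (rho * z) = hexNorm z := by
  rw [rho_mul]; simp only [hexNorm]; omega

theorem hexNorm_rho_pow_mul (k : ℕ) (z : EJInt) : hexNorm (rho ^ k * z) = hexNorm z := by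
  induction k with
  | zero => simp
  | succ k ih => rw [pow_succ', mul_assoc, hexNorm_rho_mul, ih]

theorem hexNorm_zero : hexNorm 0 = 0 := by simp [hexNorm]

theorem hexNorm_neg (z : EJInt) : hexNorm (-z) = hexNorm z := by
  simp only [hexNorm, QuadraticAlgebra.re_neg, QuadraticAlgebra.im_neg]; omega

theorem hexNorm_add_le (z w : EJInt) : hexNorm (z + w) ≤ hexNorm z + hexNorm w := by
  have key : ∀ {z : EJInt} {m : ℕ}, hexNorm z ≤ m ↔
      z.re.natAbs ≤ m ∧ z.im.natAbs ≤ m ∧ (z.re + z.im).natAbs ≤ m := by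
    intro z m; simp only [hexNorm, max_le_iff]
  obtain ⟨h1, h2, h3⟩ := key.1 (le_refl (hexNorm z))
  obtain ⟨h4, h5, h6⟩ := key.1 (le_refl (hexNorm w))
  generalize hexNorm z = m at *
  generalize hexNorm w = l at *
  simp only [key, QuadraticAlgebra.re_add, QuadraticAlgebra.im_add]
  exact ⟨by omega, by omega, by omega⟩

theorem hexNorm_rho_pow (k : ℕ) : hexNorm (rho ^ k) = 1 := by
  rw [← mul_one (rho ^ k), hexNorm_rho_pow_mul]; rfl

theorem hexNorm_eq_zero {z : EJInt} (h : hexNorm z = 0) : z = 0 := by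
  simp only [hexNorm] at h
  ext
  · simp only [QuadraticAlgebra.re_zero]; omega
  · simp only [QuadraticAlgebra.im_zero]; omega

theorem rho_pow_mul_cancel {k : ℕ} (hk : k ≤ 6) (z : EJInt) :
    rho ^ k * (rho ^ (6 - k) * z) = z := by
  rw [← mul_assoc, ← pow_add, show k + (6 - k) = 6 by omega, rho_pow_six, one_mul]

/-- Every nonzero element is a rotation of an element of the half-open first sector. -/
theorem exists_sector {z : EJInt} (hz : z ≠ 0) :
    ∃ k < 6, ∃ i j : ℕ, 1 ≤ i ∧ i + j = hexNorm z ∧ z = rho ^ k * ⟨(i : ℤ), (j : ℤ)⟩ := by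
  suffices h : ∃ k < 6, 1 ≤ (rho ^ k * z).re ∧ 0 ≤ (rho ^ k * z).im by
    obtain ⟨k, hk, h1, h2⟩ := h
    have key : ∃ i j : ℕ, 1 ≤ i ∧ i + j = hexNorm z ∧ rho ^ k * z = ⟨(i : ℤ), (j : ℤ)⟩ := by
      refine ⟨(rho ^ k * z).re.toNat, (rho ^ k * z).im.toNat, by omega, ?_, ?_⟩
      · rw [← hexNorm_rho_pow_mul k z]; simp only [hexNorm]; omega
      · ext
        · simp only; omega
        · simp only; omega
    obtain ⟨i, j, hi, hij, e⟩ := key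
    rcases Nat.eq_zero_or_pos k with rfl | hk0
    · exact ⟨0, by omega, i, j, hi, hij, by simpa using e⟩
    · refine ⟨6 - k, by omega, i, j, hi, hij, ?_⟩
      rw [← e]
      have := rho_pow_mul_cancel (k := 6 - k) (by omega) z
      rwa [show 6 - (6 - k) = k by omega, eq_comm] at this
  have hne : z.re ≠ 0 ∨ z.im ≠ 0 := by
    by_contra! h
    exact hz (by ext <;> simp [h.1, h.2])
  have h4 : rho ^ 4 * z = rho * -z := by
    rw [show rho ^ 4 = rho ^ 3 * rho from pow_succ _ _, rho_cube]; ring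
  have h5 : rho ^ 5 * z = rho ^ 2 * -z := by
    rw [show rho ^ 5 = rho ^ 3 * rho ^ 2 from by rw [← pow_add], rho_cube]; ring
  have h2 : ∀ z, rho ^ 2 * z = rho * (rho * z) := fun z => by ring
  -- The six rotates of the half-open sector partition the nonzero points; failing the first five
  -- tests leaves the sixth to linear arithmetic.
  by_cases c0 : 1 ≤ z.re ∧ 0 ≤ z.im
  · exact ⟨0, by omega, by simpa using c0⟩
  by_cases c1 : 1 ≤ (rho * z).re ∧ 0 ≤ (rho * z).im
  · exact ⟨1, by omega, by simpa using c1⟩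
  by_cases c2 : 1 ≤ (rho ^ 2 * z).re ∧ 0 ≤ (rho ^ 2 * z).im
  · exact ⟨2, by omega, c2⟩
  by_cases c3 : 1 ≤ (rho ^ 3 * z).re ∧ 0 ≤ (rho ^ 3 * z).im
  · exact ⟨3, by omega, c3⟩
  by_cases c4 : 1 ≤ (rho ^ 4 * z).re ∧ 0 ≤ (rho ^ 4 * z).im
  · exact ⟨4, by omega, c4⟩
  refine ⟨5, by omega, ?_⟩
  rw [h4] at c4
  rw [h5]
  simp only [h2, rho_cube, rho_mul, neg_one_mul, QuadraticAlgebra.re_neg,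
    QuadraticAlgebra.im_neg] at c1 c2 c3 c4 ⊢
  omega

/-- Rotate into the half-open sector: there the first coordinate is at least 1, and lowering it by 1
lowers the norm by 1. This is the descent that produces geodesics. -/
theorem exists_rho_pow_sub {z : EJInt} (hz : z ≠ 0) :
    ∃ k, hexNorm (z - rho ^ k) + 1 = hexNorm z := by
  obtain ⟨k, -, i, j, hi, hij, e⟩ := exists_sector hz
  refine ⟨k, ?_⟩
  have : z - rho ^ k = rho ^ k * ⟨(i : ℤ) - 1, (j : ℤ)⟩ := by
    have e2 : (⟨(i : ℤ) - 1, (j : ℤ)⟩ : EJInt) = ⟨(i : ℤ), (j : ℤ)⟩ - 1 := by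
      ext <;> simp [QuadraticAlgebra.re_one, QuadraticAlgebra.im_one]
    rw [e2, mul_sub, ← e, mul_one]
  rw [this, hexNorm_rho_pow_mul, ← hij]
  simp only [hexNorm]
  omega

/-! ### Cayley graphs of quotients of the Eisenstein–Jacobi integers -/

section Cayley

variable {A : Type*} [CommRing A] (f : EJInt →+* A)

/-- The Cayley graph whose connection set is the image of the units of `ℤ[ρ]`. -/
def hexCayley : SimpleGraph A :=
  circulantGraph (f '' {1, -1, rho, -rho, rho ^ 2, -rho ^ 2})

theorem units_eq_pow (z : EJInt) :
    z ∈ ({1, -1, rho, -rho, rho ^ 2, -rho ^ 2} : Set EJInt) ↔ ∃ k, z = rho ^ k := by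
  simp only [Set.mem_insert_iff, Set.mem_singleton_iff]
  have h4 : rho ^ 4 = -rho := by rw [show rho ^ 4 = rho ^ 3 * rho from pow_succ _ _, rho_cube]; ring
  have h5 : rho ^ 5 = -rho ^ 2 := by
    rw [show rho ^ 5 = rho ^ 3 * rho ^ 2 from by rw [← pow_add], rho_cube]; ring
  constructor
  · rintro (h | h | h | h | h | h)
    · exact ⟨0, by simp [h]⟩
    · exact ⟨3, by simp [h, rho_cube]⟩
    · exact ⟨1, by simp [h]⟩
    · exact ⟨4, by rw [h, h4]⟩
    · exact ⟨2, h⟩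
    · exact ⟨5, by rw [h, h5]⟩
  · rintro ⟨k, rfl⟩
    have : rho ^ k = rho ^ (k % 6) := by
      conv_lhs => rw [← Nat.div_add_mod k 6, pow_add, pow_mul, rho_pow_six, one_pow, one_mul]
    rw [this]
    have hk : k % 6 < 6 := Nat.mod_lt _ (by norm_num)
    generalize k % 6 = m at hk
    interval_cases m
    · simp
    · simp
    · simp
    · simp [rho_cube]
    · simp [h4]
    · simp [h5]

/-- The units are the powers of `ρ`, and `ρ ^ 3 = -1` makes the relation symmetric. The condition `x
≠ y` stays because `f` may kill units. -/
theorem hexCayley_adj {x y : A} : (hexCayley f).Adj x y ↔ x ≠ y ∧ ∃ k, y = x + f rho ^ k := by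
  have hm : ∀ u : A, u ∈ f '' {1, -1, rho, -rho, rho ^ 2, -rho ^ 2} ↔ ∃ k, u = f rho ^ k := by
    intro u
    constructor
    · rintro ⟨z, hz, rfl⟩
      obtain ⟨k, rfl⟩ := (units_eq_pow z).1 hz
      exact ⟨k, map_pow _ _ _⟩
    · rintro ⟨k, rfl⟩
      exact ⟨rho ^ k, (units_eq_pow _).2 ⟨k, rfl⟩, map_pow _ _ _⟩
  have h3 : f rho ^ 3 = -1 := by rw [← map_pow, rho_cube]; simp
  simp only [hexCayley, circulantGraph, fromRel_adj, hm]
  refine and_congr_right fun _ => ⟨?_, ?_⟩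
  · rintro (⟨k, hk⟩ | ⟨k, hk⟩)
    · exact ⟨k + 3, by rw [pow_add, h3, ← hk]; ring⟩
    · exact ⟨k, by rw [← hk]; ring⟩
  · rintro ⟨k, rfl⟩
    exact Or.inr ⟨k, by ring⟩

theorem hexCayley_adj_add {x y : A} (u : A) :
    (hexCayley f).Adj (x + u) (y + u) ↔ (hexCayley f).Adj x y := by
  rw [hexCayley_adj, hexCayley_adj]
  refine and_congr (by simp) (exists_congr fun k => ?_)
  rw [add_right_comm]; simp

/-- Translation as an automorphism. -/
def hexCayleyTranslate (u : A) : hexCayley f ≃g hexCayley f where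
  toEquiv := Equiv.addRight u
  map_rel_iff' := hexCayley_adj_add f u

theorem dist_iso {V W : Type*} {G : SimpleGraph V} {G' : SimpleGraph W} (φ : G ≃g G') (u v : V) :
    G'.dist (φ u) (φ v) = G.dist u v := by
  have key : ∀ {V W : Type _} {G : SimpleGraph V} {G' : SimpleGraph W} (φ : G ≃g G') (u v : V),
      G.Reachable u v → G'.dist (φ u) (φ v) ≤ G.dist u v := by
    intro V W G G' φ u v h
    obtain ⟨p, hp⟩ := h.exists_walk_length_eq_dist
    rw [← hp, ← Walk.length_map φ.toHom p]
    exact dist_le _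
  by_cases h : G.Reachable u v
  · refine le_antisymm (key φ u v h) ?_
    have h' : G'.Reachable (φ u) (φ v) := φ.reachable_iff.2 h
    obtain ⟨p, hp⟩ := h'.exists_walk_length_eq_dist
    rw [← hp, ← Walk.length_map φ.symm.toHom p]
    have e : ∀ x, φ.symm.toHom (φ x) = x := fun x => φ.symm_apply_apply x
    have := dist_le ((p.map φ.symm.toHom).copy (e u) (e v))
    simpa using this
  · rw [dist_eq_zero_of_not_reachable h,
      dist_eq_zero_of_not_reachable (mt φ.reachable_iff.1 h)]

theorem hexCayley_dist_add (x y u : A) :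
    (hexCayley f).dist (x + u) (y + u) = (hexCayley f).dist x y :=
  dist_iso (hexCayleyTranslate f u) x y

theorem hexCayley_dist_eq (x y : A) : (hexCayley f).dist x y = (hexCayley f).dist 0 (y - x) := by
  rw [← hexCayley_dist_add f 0 (y - x) x]; simp

theorem exists_walk_hexCayley (z : EJInt) :
    ∃ p : (hexCayley f).Walk 0 (f z), p.length ≤ hexNorm z := by
  generalize hm : hexNorm z = m
  induction m generalizing z with
  | zero =>
    rw [hexNorm_eq_zero hm, map_zero]
    exact ⟨Walk.nil, le_rfl⟩
  | succ m ih =>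
    have hz : z ≠ 0 := by rintro rfl; simp [hexNorm_zero] at hm
    obtain ⟨k, hk⟩ := exists_rho_pow_sub hz
    obtain ⟨p, hp⟩ := ih (z - rho ^ k) (by omega)
    -- In a degenerate quotient this step would be a loop; it is then omitted, so only an upper
    -- bound on the length is claimed.
    by_cases he : f (z - rho ^ k) = f z
    · exact ⟨p.copy rfl he, by simp; omega⟩
    · refine ⟨p.concat ((hexCayley_adj f).2 ⟨he, k, by simp⟩), by simp; omega⟩

/-- A walk lifts to the lattice edge by edge, and each edge adds a unit, of norm 1. Together with
`exists_walk_hexCayley` this identifies distance with minimal norm. -/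
theorem exists_hexNorm_le_of_walk {x y : A} (p : (hexCayley f).Walk x y) :
    ∃ z, f z = y - x ∧ hexNorm z ≤ p.length := by
  induction p with
  | nil => exact ⟨0, by simp, by simp [hexNorm_zero]⟩
  | cons h p ih =>
    obtain ⟨z, hz, hl⟩ := ih
    obtain ⟨-, k, hk⟩ := (hexCayley_adj f).1 h
    refine ⟨z + rho ^ k, ?_, ?_⟩
    · rw [map_add, hz, map_pow, hk]; ring
    · have := hexNorm_add_le z (rho ^ k)
      rw [hexNorm_rho_pow] at this
      simp only [Walk.length_cons]; omega

theorem hexCayley_dist_le (z : EJInt) : (hexCayley f).dist 0 (f z) ≤ hexNorm z := by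
  obtain ⟨p, hp⟩ := exists_walk_hexCayley f z
  exact (dist_le p).trans hp

variable {f} (hf : Function.Surjective f)
include hf

theorem hexCayley_connected : (hexCayley f).Connected := by
  have h0 : ∀ x, (hexCayley f).Reachable 0 x := fun x => by
    obtain ⟨z, rfl⟩ := hf x
    exact ⟨(exists_walk_hexCayley f z).choose⟩
  exact (connected_iff _).2 ⟨fun x y => (h0 x).symm.trans (h0 y), ⟨0⟩⟩

theorem exists_hexNorm_eq_dist (x : A) : ∃ z, f z = x ∧ hexNorm z = (hexCayley f).dist 0 x := by
  obtain ⟨p, hp⟩ := (hexCayley_connected hf).exists_walk_length_eq_dist 0 x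
  obtain ⟨z, hz, hl⟩ := exists_hexNorm_le_of_walk f p
  rw [sub_zero] at hz
  refine ⟨z, hz, le_antisymm (hl.trans hp.le) ?_⟩
  rw [← hz]; exact hexCayley_dist_le f z

theorem lt_hexCayley_dist_iff (x : A) (t : ℕ) :
    t < (hexCayley f).dist 0 x ↔ ∀ z, f z = x → t < hexNorm z := by
  constructor
  · rintro h z rfl
    exact h.trans_le (hexCayley_dist_le f z)
  · intro h
    obtain ⟨z, hz, e⟩ := exists_hexNorm_eq_dist hf x
    rw [← e]; exact h z hz

end Cayley

/-! ### Counting lattice points in triangles and hexagons -/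

/-- The pairs of natural numbers with sum less than `m`. -/
def triangle (m : ℕ) : Finset (ℕ × ℕ) := (Finset.range m).biUnion Finset.HasAntidiagonal.antidiagonal

theorem mem_triangle {m : ℕ} {q : ℕ × ℕ} : q ∈ triangle m ↔ q.1 + q.2 < m := by
  simp [triangle]

theorem card_triangle (m : ℕ) : 2 * (triangle m).card = m * (m + 1) := by
  rw [triangle, Finset.card_biUnion]
  · simp only [Finset.Nat.card_antidiagonal]
    induction m with
    | zero => rfl
    | succ m ih => rw [Finset.sum_range_succ, mul_add, ih]; ring
  · intro x _ y _ hxy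
    rw [Function.onFun, Finset.disjoint_left]
    intro q h1 h2
    rw [Finset.HasAntidiagonal.mem_antidiagonal] at h1 h2
    exact hxy (h1.symm.trans h2)

/-- The hexagon is the square `[-t, t]²` with two opposite corner triangles removed, `x + y > t` and
`x + y < -t`, each of `t(t + 1)/2` points. -/
theorem ncard_hexBall (t : ℕ) : {z : EJInt | hexNorm z ≤ t}.ncard = 3 * t ^ 2 + 3 * t + 1 := by
  classical
  set S : Finset (ℤ × ℤ) := Finset.Icc (-t : ℤ) t ×ˢ Finset.Icc (-t : ℤ) t with hS
  set U : Finset (ℤ × ℤ) := (triangle t).image fun q => ((t : ℤ) - q.1, (t : ℤ) - q.2) with hU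
  set L : Finset (ℤ × ℤ) := (triangle t).image fun q => ((q.1 : ℤ) - t, (q.2 : ℤ) - t) with hL
  have hUc : U.card = (triangle t).card := Finset.card_image_of_injective _ fun q r h => by
    simp only [Prod.mk.injEq] at h
    ext <;> omega
  have hLc : L.card = (triangle t).card := Finset.card_image_of_injective _ fun q r h => by
    simp only [Prod.mk.injEq] at h
    ext <;> omega
  have mU : ∀ x : ℤ × ℤ, x ∈ U ↔ x.1 ≤ t ∧ x.2 ≤ t ∧ t < x.1 + x.2 := by
    rintro ⟨x, y⟩
    simp only [hU, Finset.mem_image, mem_triangle, Prod.mk.injEq, Prod.exists]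
    constructor
    · rintro ⟨i, j, h, rfl, rfl⟩; omega
    · intro h; exact ⟨(t - x).toNat, (t - y).toNat, by omega, by omega, by omega⟩
  have mL : ∀ x : ℤ × ℤ, x ∈ L ↔ -t ≤ x.1 ∧ -t ≤ x.2 ∧ x.1 + x.2 < -t := by
    rintro ⟨x, y⟩
    simp only [hL, Finset.mem_image, mem_triangle, Prod.mk.injEq, Prod.exists]
    constructor
    · rintro ⟨i, j, h, rfl, rfl⟩; omega
    · intro h; exact ⟨(x + t).toNat, (y + t).toNat, by omega, by omega, by omega⟩
  have hdis : Disjoint U L := by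
    rw [Finset.disjoint_left]
    intro x h1 h2
    rw [mU] at h1; rw [mL] at h2; omega
  have hsub : U ∪ L ⊆ S := by
    intro x hx
    simp only [Finset.mem_union, mU, mL] at hx
    simp only [hS, Finset.mem_product, Finset.mem_Icc]; omega
  have hball : {z : EJInt | hexNorm z ≤ t}.ncard = (S \ (U ∪ L)).card := by
    rw [← Set.ncard_coe_finset]
    refine Set.ncard_congr (fun z _ => (z.re, z.im)) ?_ ?_ ?_
    · intro z hz
      simp only [Set.mem_ofPred_eq, hexNorm, max_le_iff] at hz
      simp only [Finset.coe_sdiff, Set.mem_sdiff, Finset.mem_coe, Finset.mem_union, mU, mL, hS,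
        Finset.mem_product, Finset.mem_Icc]
      omega
    · intro z w _ _ h
      simp only [Prod.mk.injEq] at h
      ext
      · exact h.1
      · exact h.2
    · rintro ⟨x, y⟩ h
      refine ⟨⟨x, y⟩, ?_, rfl⟩
      simp only [Finset.coe_sdiff, Set.mem_sdiff, Finset.mem_coe, Finset.mem_union, mU, mL, hS,
        Finset.mem_product, Finset.mem_Icc] at h
      simp only [Set.mem_ofPred_eq, hexNorm, max_le_iff]
      omega
  have hSc : S.card = (2 * t + 1) * (2 * t + 1) := by
    rw [hS, Finset.card_product, Int.card_Icc]
    congr 1 <;> omega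
  rw [hball, Finset.card_sdiff_of_subset hsub, Finset.card_union_of_disjoint hdis, hUc, hLc, hSc]
  have := card_triangle t
  rw [← two_mul, this]
  apply Nat.sub_eq_of_eq_add
  ring

/-! ### The distance distribution of Eisenstein–Jacobi graphs -/

section Distribution

variable {c d : ℕ}

theorem generator_mul (w : EJInt) : (⟨(c : ℤ), (d : ℤ)⟩ : EJInt) * w =
    ⟨c * w.re - d * w.im, d * w.re + (c + d) * w.im⟩ := by
  ext <;> simp <;> ring

/-- Every point of the lattice `αℤ[ρ]` lies beyond one of the sides of the triangle with vertices
`0`, `α`, `ρα`. -/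
theorem lattice_outside (hdc : d ≤ c) (hc : 0 < c) (p q : ℤ) :
    (c : ℤ) ≤ c * p - d * q ∨ (c + d : ℤ) ≤ d * p + (c + d) * q ∨
      (c * p - d * q) + (d * p + (c + d) * q) ≤ 0 := by
  by_contra! h
  obtain ⟨h1, h2, h3⟩ := h
  have hc' : (0 : ℤ) < c := by exact_mod_cast hc
  have hd' : (0 : ℤ) ≤ d := by positivity
  have hdc' : (d : ℤ) ≤ c := by exact_mod_cast hdc
  -- If `q ≥ 1`, then `p` is negative and `-p < q`, and the second coordinate is at least `c + d`
  -- after all; if `q ≤ 0`, then `p ≤ 0` and the coordinate sum is not positive.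
  rcases le_or_gt 1 q with hq | hq
  · have hp : p < 0 := by
      by_contra! hp
      nlinarith
    have hr : -p < q := by
      by_contra! hr
      nlinarith
    nlinarith
  · have hp : p < 1 := by
      by_contra! hp
      nlinarith
    nlinarith

/-- With `w` rotated to `i + jρ` in the sector, the coordinate sum of the product is `(c + d)i +
cj`, already at least `c + d`. -/
theorem le_hexNorm_generator_mul {w : EJInt} (hw : w ≠ 0) :
    c + d ≤ hexNorm ((⟨(c : ℤ), (d : ℤ)⟩ : EJInt) * w) := by
  obtain ⟨k, -, i, j, hi, -, rfl⟩ := exists_sector hw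
  rw [mul_left_comm, hexNorm_rho_pow_mul, generator_mul]
  have h : ((c * (i : ℤ) - d * (j : ℤ)) + (d * (i : ℤ) + (c + d) * (j : ℤ))).natAbs
      = (c + d) * i + c * j := by
    rw [show (c * (i : ℤ) - d * (j : ℤ)) + (d * (i : ℤ) + (c + d) * (j : ℤ))
      = (((c + d) * i + c * j : ℕ) : ℤ) by push_cast; ring, Int.natAbs_natCast]
  refine le_trans ?_ ((le_max_right _ _).trans (le_max_right _ _))
  rw [h]
  exact le_trans (Nat.le_mul_of_pos_right _ hi) (Nat.le_add_right _ _)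

/-- The point of the triangle of points at distance greater than `t` from `0`, `α`, `ρα`. -/
def holePoint (c d t : ℕ) (q : ℕ × ℕ) : EJInt := ⟨(c : ℤ) - t - 1 - q.1, (c : ℤ) + d - t - 1 - q.2⟩

/-- A hole point is at least `t + 1` inside each side of the triangle of `lattice_outside`. A
lattice point is on or beyond some side, so the corresponding coordinate of the difference exceeds
`t`. -/
theorem lt_hexNorm_holePoint_add (hdc : d ≤ c) (hc : 0 < c) {t : ℕ} {q : ℕ × ℕ}
    (hq : q ∈ triangle (2 * c + d - (3 * t + 2))) (w : EJInt) :
    t < hexNorm (holePoint c d t q + (⟨(c : ℤ), (d : ℤ)⟩ : EJInt) * w) := by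
  have h := lattice_outside hdc hc (-w.re) (-w.im)
  rw [mem_triangle] at hq
  rw [generator_mul]
  simp only [mul_neg] at h
  simp only [hexNorm, holePoint, QuadraticAlgebra.re_add, QuadraticAlgebra.im_add, lt_max_iff]
  generalize (c : ℤ) * w.re = a1 at *
  generalize (d : ℤ) * w.im = a2 at *
  generalize (d : ℤ) * w.re = a3 at *
  generalize ((c : ℤ) + d) * w.im = a4 at *
  omega

/-- A rotation by 60° turns the triangle upside down, up to a lattice translation; therefore only
the triangle and its negative occur modulo the lattice. -/
theorem rho_mul_holePoint {t : ℕ} {q : ℕ × ℕ}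
    (hq : q ∈ triangle (2 * c + d - (3 * t + 2))) :
    ∃ q' ∈ triangle (2 * c + d - (3 * t + 2)),
      rho * holePoint c d t q = -holePoint c d t q' + (⟨(c : ℤ), (d : ℤ)⟩ : EJInt) * rho := by
  rw [mem_triangle] at hq
  refine ⟨(q.2, 2 * c + d - (3 * t + 2) - 1 - q.1 - q.2), ?_, ?_⟩
  · rw [mem_triangle]; simp only; omega
  · rw [rho_mul, generator_mul]
    ext
    · simp [holePoint, rho]; ring
    · simp only [holePoint, rho, QuadraticAlgebra.im_add, QuadraticAlgebra.im_neg]; omega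

/-- A closest representative in the first sector lies in the triangle. -/
theorem exists_holePoint_of_minimal (hdc : d ≤ c) (hc : 0 < c) {t i j : ℕ} (ht : c + d ≤ 2 * t + 1)
    (hi : 1 ≤ i) (hij : t < i + j)
    (hmin : ∀ w : EJInt,
      i + j ≤ hexNorm (⟨(i : ℤ), (j : ℤ)⟩ - (⟨(c : ℤ), (d : ℤ)⟩ : EJInt) * w)) :
    ∃ q ∈ triangle (2 * c + d - (3 * t + 2)), holePoint c d t q = ⟨(i : ℤ), (j : ℤ)⟩ := by
  have h1 := hmin 1
  have h2 := hmin rho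
  rw [generator_mul] at h1 h2
  simp only [hexNorm, QuadraticAlgebra.re_sub, QuadraticAlgebra.im_sub, QuadraticAlgebra.re_one,
    QuadraticAlgebra.im_one, rho, le_max_iff, mul_one, mul_zero] at h1 h2
  -- Being no closer to `α` than to `0` could be witnessed by any of three coordinates; `c + d ≤ 2t
  -- + 1` and `t < i + j` exclude all but the first. Comparison with `ρα` likewise gives the second
  -- bound.
  have hx : i + t + 1 ≤ c := by omega
  have hy : j + t + 1 ≤ c + d := by omega
  refine ⟨(c - t - 1 - i, c + d - t - 1 - j), ?_, ?_⟩
  · rw [mem_triangle]; simp only; omega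
  · ext
    · simp only [holePoint]; omega
    · simp only [holePoint]; omega

variable {A : Type*} [CommRing A] {f : EJInt →+* A} (hf : Function.Surjective f)
  (hker : ∀ z, f z = 0 ↔ ∃ w, z = (⟨(c : ℤ), (d : ℤ)⟩ : EJInt) * w)
include hf hker

theorem setOf_lt_dist_eq (hdc : d ≤ c) (hc : 0 < c) {t : ℕ} (ht : c + d ≤ 2 * t + 1) :
    {x | t < (hexCayley f).dist 0 x} =
      (fun b : Bool × (ℕ × ℕ) => f (cond b.1 1 (-1) * holePoint c d t b.2)) ''
        ((Finset.univ ×ˢ triangle (2 * c + d - (3 * t + 2)) : Finset (Bool × (ℕ × ℕ))) :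
          Set (Bool × (ℕ × ℕ))) := by
  ext x
  simp only [Set.mem_ofPred_eq, Set.mem_image, Finset.mem_coe, Finset.mem_product, Finset.mem_univ,
    true_and, Prod.exists (α := Bool), Bool.exists_bool, cond_true, cond_false]
  have hα : f ⟨(c : ℤ), (d : ℤ)⟩ = 0 := (hker _).2 ⟨1, (mul_one _).symm⟩
  constructor
  · intro hx
    obtain ⟨z, rfl, hz⟩ := exists_hexNorm_eq_dist hf x
    rw [lt_hexCayley_dist_iff hf] at hx
    have hz0 : z ≠ 0 := by
      rintro rfl
      have := hx 0 rfl
      rw [hexNorm_zero] at this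
      omega
    obtain ⟨k, -, i, j, hi, hij, e⟩ := exists_sector hz0
    obtain ⟨q, hq, hq'⟩ := exists_holePoint_of_minimal (c := c) (d := d) hdc hc ht hi
        (by rw [hij]; exact hx z rfl) (fun w => by
      rw [hij, hz, e, ← hexNorm_rho_pow_mul k]
      refine le_trans (le_of_eq ?_) (hexCayley_dist_le f _)
      rw [mul_sub, map_sub, mul_left_comm, map_mul f ⟨(c : ℤ), (d : ℤ)⟩, hα, zero_mul, sub_zero])
    rw [e, ← hq']
    -- Only the rotation exponent `k` matters from here: by induction each further rotation
    -- exchanges the two triangles.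
    clear e hz hx hq' hij hi
    induction k with
    | zero => exact Or.inr ⟨q, hq, by simp⟩
    | succ k ih =>
      have step : ∀ q ∈ triangle (2 * c + d - (3 * t + 2)),
          ∃ q' ∈ triangle (2 * c + d - (3 * t + 2)),
            f (rho * holePoint c d t q) = -f (holePoint c d t q') := by
        intro q hq
        obtain ⟨q', h1, h2⟩ := rho_mul_holePoint hq
        exact ⟨q', h1, by rw [h2, map_add, map_mul, hα, zero_mul, add_zero, map_neg]⟩
      rw [pow_succ', mul_assoc, map_mul]
      rcases ih with ⟨q1, h1, h2⟩ | ⟨q1, h1, h2⟩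
      · obtain ⟨q', h3, h4⟩ := step q1 h1
        refine Or.inr ⟨q', h3, ?_⟩
        rw [← h2, ← map_mul, mul_left_comm, map_mul _ _ (rho * _), h4]; simp
      · obtain ⟨q', h3, h4⟩ := step q1 h1
        refine Or.inl ⟨q', h3, ?_⟩
        rw [← h2, ← map_mul, mul_left_comm, map_mul _ _ (rho * _), h4]; simp
  · have key : ∀ q ∈ triangle (2 * c + d - (3 * t + 2)), ∀ z, f z = f (holePoint c d t q) →
        t < hexNorm z := by
      intro q hq z hz
      obtain ⟨w, hw⟩ := (hker (z - holePoint c d t q)).1 (by rw [map_sub, hz, sub_self])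
      rw [sub_eq_iff_eq_add'] at hw
      rw [hw]; exact lt_hexNorm_holePoint_add hdc hc hq w
    rw [lt_hexCayley_dist_iff hf]
    rintro (⟨q, hq, rfl⟩ | ⟨q, hq, rfl⟩) z hz
    · rw [← hexNorm_neg]
      refine key q hq _ ?_
      rw [map_neg, hz]; simp
    · exact key q hq z (by simpa using hz)

/-- The two triangles inject into the quotient and have disjoint images. Truncated subtraction makes
them empty once `t` is too large. -/
theorem ncard_lt_dist (hdc : d ≤ c) (hc : 0 < c) {t : ℕ} (ht : c + d ≤ 2 * t + 1) :
    {x | t < (hexCayley f).dist 0 x}.ncard =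
      (2 * c + d - (3 * t + 2)) * (2 * c + d - (3 * t + 2) + 1) := by
  rw [setOf_lt_dist_eq hf hker hdc hc ht, Set.InjOn.ncard_image, Set.ncard_coe_finset,
    Finset.card_product, ← card_triangle]
  · simp
  have same : ∀ q ∈ triangle (2 * c + d - (3 * t + 2)), ∀ r ∈ triangle (2 * c + d - (3 * t + 2)),
      f (holePoint c d t q) = f (holePoint c d t r) → q = r := by
    intro q hq r hr h
    rw [mem_triangle] at hq hr
    obtain ⟨w, hw⟩ := (hker (holePoint c d t q - holePoint c d t r)).1 (by rw [map_sub, h, sub_self])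
    rcases eq_or_ne w 0 with rfl | hw0
    · rw [mul_zero, sub_eq_zero, holePoint, holePoint, QuadraticAlgebra.mk.injEq] at hw
      ext <;> omega
    -- Two points of the triangle differ by less than `c + d` in norm, too little for a nonzero
    -- lattice vector.
    · have := le_hexNorm_generator_mul (c := c) (d := d) hw0
      rw [← hw] at this
      simp only [holePoint, hexNorm, QuadraticAlgebra.re_sub, QuadraticAlgebra.im_sub,
        le_max_iff] at this
      omega
  have opp : ∀ q ∈ triangle (2 * c + d - (3 * t + 2)), ∀ r ∈ triangle (2 * c + d - (3 * t + 2)),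
      f (holePoint c d t q) ≠ -f (holePoint c d t r) := by
    intro q hq r hr h
    rw [mem_triangle] at hq hr
    obtain ⟨w, hw⟩ := (hker (holePoint c d t q + holePoint c d t r)).1
      (by rw [map_add, h, neg_add_cancel])
    rw [generator_mul] at hw
    have h1 := congrArg QuadraticAlgebra.re hw
    have h2 := congrArg QuadraticAlgebra.im hw
    simp only [holePoint, QuadraticAlgebra.re_add, QuadraticAlgebra.im_add] at h1 h2
    -- The sum of two hole points is strictly inside the triangle of `lattice_outside`, since `c + d
    -- ≤ 2t + 1`; hence it is not a lattice point.
    have := lattice_outside hdc hc w.re w.im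
    rw [← h1, ← h2] at this
    omega
  rintro ⟨b, q⟩ hq ⟨b', r⟩ hr h
  simp only [Finset.coe_product, Set.mem_prod, Finset.mem_coe] at hq hr
  rcases b <;> rcases b' <;> simp only [cond_true, cond_false, neg_mul, one_mul, map_neg] at h
  · rw [same q hq.2 r hr.2 (neg_injective h)]
  · exact absurd h.symm (opp r hr.2 q hq.2)
  · exact absurd h (opp q hq.2 r hr.2)
  · rw [same q hq.2 r hr.2 h]

/-- Two points of the lattice ball differ by at most `2t` in norm, less than any nonzero lattice
vector, so the ball embeds in the quotient. -/
theorem ncard_dist_le {t : ℕ} (ht : 2 * t < c + d) :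
    {x | (hexCayley f).dist 0 x ≤ t}.ncard = 3 * t ^ 2 + 3 * t + 1 := by
  rw [← ncard_hexBall, ← Set.InjOn.ncard_image (f := f) (s := {z | hexNorm z ≤ t})]
  · congr 1
    ext x
    constructor
    · intro hx
      obtain ⟨z, hz, h⟩ := exists_hexNorm_eq_dist hf x
      exact ⟨z, by rw [Set.mem_ofPred_eq, h]; exact hx, hz⟩
    · rintro ⟨z, hz, rfl⟩
      exact (hexCayley_dist_le f z).trans hz
  · intro z hz z' hz' h
    obtain ⟨w, hw⟩ := (hker (z - z')).1 (by rw [map_sub, h, sub_self])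
    rcases eq_or_ne w 0 with rfl | hw0
    · rwa [mul_zero, sub_eq_zero] at hw
    · have h1 := le_hexNorm_generator_mul (c := c) (d := d) hw0
      have h2 := hexNorm_add_le z (-z')
      rw [← sub_eq_add_neg, hw, hexNorm_neg] at h2
      simp only [Set.mem_ofPred_eq] at hz hz'
      omega

end Distribution

/-! ### Diameter and sum of the distances in closed form -/

section DistanceSum

variable {c d : ℕ} {A : Type*} [CommRing A] [Fintype A] {f : EJInt →+* A}
  (hf : Function.Surjective f)
  (hker : ∀ z, f z = 0 ↔ ∃ w, z = (⟨(c : ℤ), (d : ℤ)⟩ : EJInt) * w)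
  (hcard : Fintype.card A = c ^ 2 + c * d + d ^ 2)

theorem ncard_lt_add_ncard_le {α : Type*} [Fintype α] (g : α → ℕ) (t : ℕ) :
    {x | t < g x}.ncard + {x | g x ≤ t}.ncard = Fintype.card α := by
  have : {x | g x ≤ t} = {x | t < g x}ᶜ := by ext x; simp
  rw [this, Set.ncard_add_ncard_compl, Nat.card_eq_fintype_card]

theorem sum_eq_sum_ncard_lt {α : Type*} [Fintype α] (g : α → ℕ) {D : ℕ} (hD : ∀ x, g x ≤ D) :
    ∑ x, g x = ∑ t ∈ Finset.range D, {x | t < g x}.ncard := by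
  classical
  have h : ∀ t, {x | t < g x}.ncard = ∑ x, if t < g x then 1 else 0 := fun t => by
    rw [Finset.sum_boole, ← Set.ncard_coe_finset]; simp
  simp_rw [h]
  rw [Finset.sum_comm]
  refine Finset.sum_congr rfl fun x _ => ?_
  rw [Finset.sum_boole]
  have : (Finset.range D).filter (fun t => t < g x) = Finset.range (g x) := by
    ext t
    have := hD x
    simp only [Finset.mem_filter, Finset.mem_range]; omega
  rw [this]; simp

include hf hker

theorem dist_le_of_kernel (hdc : d ≤ c) (hc : 0 < c) (x : A) :
    (hexCayley f).dist 0 x ≤ (2 * c + d) / 3 := by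
  have h := ncard_lt_dist hf hker hdc hc (t := (2 * c + d) / 3) (by omega)
  rw [show 2 * c + d - (3 * ((2 * c + d) / 3) + 2) = 0 by omega, zero_mul, Set.ncard_eq_zero] at h
  by_contra! hx
  exact (h ▸ hx : x ∈ (∅ : Set A))

include hcard

/-- One radius below `(2c + d) / 3` the far set is still nonempty: either its triangles are, or the
ball is an embedded hexagon with fewer than `c² + cd + d²` points. -/
theorem exists_dist_eq_of_kernel (hdc : d ≤ c) (hc : 0 < c) :
    ∃ x, (hexCayley f).dist 0 x = (2 * c + d) / 3 := by
  by_cases h0 : (2 * c + d) / 3 = 0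
  · exact ⟨0, by simp [h0]⟩
  suffices h : {x | (2 * c + d) / 3 - 1 < (hexCayley f).dist 0 x}.ncard ≠ 0 by
    obtain ⟨x, hx⟩ := Set.nonempty_of_ncard_ne_zero h
    have := dist_le_of_kernel hf hker hdc hc x
    rw [Set.mem_ofPred_eq] at hx
    exact ⟨x, by omega⟩
  by_cases hk : c + d ≤ 2 * ((2 * c + d) / 3 - 1) + 1
  · rw [ncard_lt_dist hf hker hdc hc hk]
    exact Nat.mul_ne_zero (by omega) (by omega)
  · have h1 := ncard_lt_add_ncard_le (fun x => (hexCayley f).dist 0 x) ((2 * c + d) / 3 - 1)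
    rw [ncard_dist_le hf hker (by omega), hcard] at h1
    intro h2
    rw [h2, zero_add] at h1
    obtain ⟨s, hs⟩ : ∃ s, (2 * c + d) / 3 = s + 1 := ⟨_, (Nat.succ_pred_eq_of_pos (by omega)).symm⟩
    rw [hs, Nat.add_sub_cancel] at h1
    have h3 : 2 * (s + 1) ≤ c + d := by omega
    nlinarith

theorem diam_eq_of_kernel (hdc : d ≤ c) (hc : 0 < c) :
    (hexCayley f).diam = (2 * c + d) / 3 := by
  apply le_antisymm
  · obtain ⟨u, v, h⟩ := (hexCayley f).exists_dist_eq_diam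
    rw [← h, hexCayley_dist_eq]
    exact dist_le_of_kernel hf hker hdc hc _
  · obtain ⟨x, hx⟩ := exists_dist_eq_of_kernel hf hker hcard hdc hc
    rw [← hx]
    exact dist_le_diam (connected_iff_ediam_ne_top.1 (hexCayley_connected hf))

/-- The sum over `t < D` of the number of vertices farther than `t` splits at `k`. Below `k`,
hexagon sizes `3t² + 3t + 1` sum to `k³`; above it, the triangle counts telescope as differences of
the cubes `(2c + d - 3t)³`. -/
theorem sum_dist_of_kernel (hdc : d ≤ c) (hc : 0 < c) {k D : ℕ} (hk : k = (c + d) / 2)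
    (hD : D = (2 * c + d) / 3) :
    ((∑ x, (hexCayley f).dist 0 x : ℕ) : ℚ) = ((c : ℚ) ^ 2 + c * d + d ^ 2) * k - k ^ 3
      + ((2 * c + d - 3 * k : ℚ) ^ 3 - (2 * c + d - 3 * D) ^ 3) / 9 - ((D : ℚ) - k) := by
  have hkD : k ≤ D := by omega
  rw [sum_eq_sum_ncard_lt _ (dist_le_of_kernel hf hker hdc hc), ← hD,
    ← Finset.sum_range_add_sum_Ico _ hkD, Nat.cast_add]
  have h1 : ∀ l ≤ k, ((∑ t ∈ Finset.range l, {x | t < (hexCayley f).dist 0 x}.ncard : ℕ) : ℚ) =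
      ((c : ℚ) ^ 2 + c * d + d ^ 2) * l - l ^ 3 := by
    intro l hl
    induction l with
    | zero => simp
    | succ l ih =>
      have e := ncard_lt_add_ncard_le (fun x => (hexCayley f).dist 0 x) l
      rw [ncard_dist_le hf hker (by omega), hcard] at e
      have e' := congrArg (Nat.cast (R := ℚ)) e
      push_cast at e'
      rw [Finset.sum_range_succ, Nat.cast_add, ih (by omega)]
      push_cast
      linear_combination e'
  have h2 : ∀ l, k ≤ l → l ≤ D →
      ((∑ t ∈ Finset.Ico k l, {x | t < (hexCayley f).dist 0 x}.ncard : ℕ) : ℚ) =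
      ((2 * c + d - 3 * k : ℚ) ^ 3 - (2 * c + d - 3 * l) ^ 3) / 9 - ((l : ℚ) - k) := by
    intro l hl
    induction l, hl using Nat.le_induction with
    | base => intro; simp
    | succ l hl ih =>
      intro hlD
      rw [Finset.sum_Ico_succ_top hl, Nat.cast_add, ih (by omega),
        ncard_lt_dist hf hker hdc hc (by omega), Nat.cast_mul, Nat.cast_add (n := 1),
        Nat.cast_sub (by omega)]
      push_cast
      ring
  rw [h1 k le_rfl, h2 D hkD le_rfl]
  ring

theorem forwarding_formula_of_kernel (hdc : d ≤ c) (hc : 0 < c) (h3 : (2 * c + d) % 3 ≠ 0)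
    {D : ℕ} (hD : D = (2 * c + d) / 3) {p : ℚ}
    (hp : 3 * p = ((∑ x, (hexCayley f).dist 0 x : ℕ) : ℚ)) :
    (Odd (c + d) → p = D * (D + 1) * ((2 * c + d) - (2 * D + 1))
          - 1 / 12 * (2 * c - d) * (((c : ℚ) + d) ^ 2 - 1)) ∧
      (Even (c + d) → p = 1 / 2 * D * (D + 1) * ((7 * c + 5 * d) - 2 * (2 * D + 1))
          + 1 / 12 * ((c : ℚ) + d) ^ 2 * (4 * c + d - 6)
          + 1 / 6 * ((c : ℚ) + d) *
            (((c : ℚ) ^ 2 + c * d + d ^ 2) - 3 * c + 3 - 6 * D * (2 * c + d))) := by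
  have hS := sum_dist_of_kernel hf hker hcard hdc hc rfl hD
  rw [← hp] at hS
  -- The two possible nonzero residues of `2c + d` modulo 3 in one polynomial relation; it
  -- reconciles the cubic sum with the stated closed forms.
  have hQ : ((2 * c + d - 3 * D - 1 : ℚ)) * (2 * c + d - 3 * D - 2) = 0 := by
    have : 2 * c + d = 3 * D + 1 ∨ 2 * c + d = 3 * D + 2 := by omega
    rcases this with h | h
    · have h' := congrArg (Nat.cast (R := ℚ)) h
      push_cast at h'
      rw [h']; ring
    · have h' := congrArg (Nat.cast (R := ℚ)) h
      push_cast at h'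
      rw [h']; ring
  constructor
  · rintro ⟨k, hk⟩
    rw [show (c + d) / 2 = k by omega] at hS
    have hk' : (k : ℚ) = (c + d - 1) / 2 := by
      have h' := congrArg (Nat.cast (R := ℚ)) hk
      push_cast at h'
      rw [h']; ring
    rw [hk'] at hS
    linear_combination hS / 3 + (D / 3) * hQ
  · rintro ⟨k, hk⟩
    rw [show (c + d) / 2 = k by omega] at hS
    have hk' : (k : ℚ) = (c + d) / 2 := by
      have h' := congrArg (Nat.cast (R := ℚ)) hk
      push_cast at h'
      rw [h']; ring
    rw [hk'] at hS
    linear_combination hS / 3 + (D / 3 - (c + d) / 6) * hQ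

end DistanceSum

/-! ### The norm and principal ideals -/

theorem norm_mk (x y : ℤ) : QuadraticAlgebra.norm (⟨x, y⟩ : EJInt) = x ^ 2 + x * y + y ^ 2 := by
  rw [QuadraticAlgebra.norm_def]; ring

theorem norm_eq (z : EJInt) : QuadraticAlgebra.norm z = z.re ^ 2 + z.re * z.im + z.im ^ 2 :=
  norm_mk z.re z.im

theorem norm_nonneg' (z : EJInt) : 0 ≤ QuadraticAlgebra.norm z := by
  rw [norm_eq]; nlinarith [sq_nonneg (z.re + z.im), sq_nonneg z.re, sq_nonneg z.im]

theorem norm_pos_of_ne_zero {z : EJInt} (hz : z ≠ 0) : 0 < QuadraticAlgebra.norm z := by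
  rw [norm_eq]
  by_contra! h
  have h1 : z.re ^ 2 ≤ 0 := by nlinarith [sq_nonneg (z.re + z.im), sq_nonneg z.im]
  have h2 : z.im ^ 2 ≤ 0 := by nlinarith [sq_nonneg (z.re + z.im), sq_nonneg z.re]
  refine hz (QuadraticAlgebra.ext ?_ ?_)
  · exact pow_eq_zero_iff (two_ne_zero) |>.1 (le_antisymm h1 (sq_nonneg _))
  · exact pow_eq_zero_iff (two_ne_zero) |>.1 (le_antisymm h2 (sq_nonneg _))

theorem norm_le_hexNorm_sq (z : EJInt) : QuadraticAlgebra.norm z ≤ (hexNorm z : ℤ) ^ 2 := by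
  rcases eq_or_ne z 0 with rfl | hz
  · simp
  obtain ⟨k, -, i, j, -, hij, e⟩ := exists_sector hz
  have hr : QuadraticAlgebra.norm rho = 1 := by rw [rho, norm_mk]; norm_num
  rw [← hij, e, map_mul, map_pow, hr, one_pow, one_mul, norm_mk]
  push_cast
  nlinarith [mul_nonneg (Int.natCast_nonneg i) (Int.natCast_nonneg j)]

/-- The index of the image of multiplication by `z` is the absolute value of its determinant over
`ℤ`, which is the norm. -/
theorem card_quotient_span (z : EJInt) (hz : z ≠ 0) :
    Nat.card (EJInt ⧸ Ideal.span {z}) = (QuadraticAlgebra.norm z).natAbs := by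
  set L := DistribSMul.toLinearMap ℤ EJInt z with hL
  have hLz : ∀ w, L w = z * w := fun w => rfl
  have hinj : Function.Injective L := by
    rw [injective_iff_map_eq_zero]
    intro w hw
    by_contra hw0
    have h1 := norm_pos_of_ne_zero hz
    have h2 := norm_pos_of_ne_zero hw0
    have h3 := congrArg QuadraticAlgebra.norm ((hLz w).symm.trans hw)
    rw [map_mul, QuadraticAlgebra.norm_zero] at h3
    exact (mul_pos h1 h2).ne' h3
  have h := Submodule.natAbs_det_equiv (LinearMap.range L) (LinearEquiv.ofInjective L hinj)
  have e : (LinearMap.range L).subtype ∘ₗ (LinearEquiv.ofInjective L hinj : EJInt →ₗ[ℤ] _) = L := by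
    ext w <;> rfl
  have e2 : LinearMap.range L = (Ideal.span {z}).restrictScalars ℤ := by
    ext w
    rw [LinearMap.mem_range, Submodule.restrictScalars_mem, Ideal.mem_span_singleton']
    exact exists_congr fun v => by rw [hLz, mul_comm]
  have h' : (LinearMap.det L).natAbs = Nat.card (EJInt ⧸ LinearMap.range L) := by
    rw [← h]; exact congrArg (fun l => (LinearMap.det l).natAbs) e.symm
  rw [hL, QuadraticAlgebra.det_toLinearMap_eq_norm, ← hL, e2] at h'
  rw [h']
  rfl

theorem exists_near_quotient (x : ℤ) {N : ℤ} (hN : 0 < N) :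
    ∃ q, 4 * (x - N * q) ^ 2 ≤ N ^ 2 := by
  refine ⟨(2 * x + N) / (2 * N), ?_⟩
  have h1 := Int.emod_nonneg (2 * x + N) (b := 2 * N) (by omega)
  have h2 := Int.emod_lt_of_pos (2 * x + N) (b := 2 * N) (by omega)
  have h3 := Int.mul_ediv_add_emod (2 * x + N) (2 * N)
  generalize (2 * x + N) / (2 * N) = q at *
  nlinarith [abs_le_of_sq_le_sq' (a := 2 * (x - N * q)) (b := N)]

theorem exists_norm_sub_mul_lt (y : EJInt) {z : EJInt} (hz : z ≠ 0) :
    ∃ q, QuadraticAlgebra.norm (y - z * q) < QuadraticAlgebra.norm z := by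
  set N := QuadraticAlgebra.norm z with hN
  have hpos : 0 < N := norm_pos_of_ne_zero hz
  obtain ⟨q1, h1⟩ := exists_near_quotient (y * star z).re hpos
  obtain ⟨q2, h2⟩ := exists_near_quotient (y * star z).im hpos
  refine ⟨⟨q1, q2⟩, ?_⟩
  have hzz : z * star z = (⟨N, 0⟩ : EJInt) := by
    rw [← QuadraticAlgebra.algebraMap_norm_eq_mul_star]; rfl
  have e : (y - z * ⟨q1, q2⟩) * star z =
      ⟨(y * star z).re - N * q1, (y * star z).im - N * q2⟩ := by
    have : (y - z * ⟨q1, q2⟩) * star z = y * star z - (z * star z) * ⟨q1, q2⟩ := by ring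
    rw [this, hzz]
    ext
    · simp only [QuadraticAlgebra.re_sub, QuadraticAlgebra.re_mul]; ring
    · simp only [QuadraticAlgebra.im_sub, QuadraticAlgebra.im_mul]; ring
  have e2 := congrArg QuadraticAlgebra.norm e
  rw [map_mul, QuadraticAlgebra.norm_star, ← hN,
    norm_mk ((y * star z).re - N * q1) ((y * star z).im - N * q2)] at e2
  generalize (y * star z).re - N * q1 = u at *
  generalize (y * star z).im - N * q2 = v at *
  by_contra! h
  -- Rounding both coordinates leaves `|u|, |v| ≤ N / 2`, so `u² + uv + v² ≤ 3N² / 4 < N²`.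
  nlinarith [sq_nonneg (u - v), mul_le_mul_of_nonneg_right h hpos.le, pow_pos hpos 2]

theorem exists_generator (I : Ideal EJInt) (hI : I ≠ ⊥) : ∃ z ≠ 0, I = Ideal.span {z} := by
  obtain ⟨y, hy, hy0⟩ := Submodule.exists_mem_ne_zero_of_ne_bot hI
  have hex : ∃ m : ℕ, ∃ z ∈ I, z ≠ 0 ∧ (QuadraticAlgebra.norm z).natAbs = m :=
    ⟨_, y, hy, hy0, rfl⟩
  classical
  obtain ⟨z, hz, hz0, hm⟩ := Nat.find_spec hex
  refine ⟨z, hz0, le_antisymm (fun w hw => ?_) ((Ideal.span_singleton_le_iff_mem _).2 hz)⟩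
  obtain ⟨q, hq⟩ := exists_norm_sub_mul_lt w hz0
  rw [Ideal.mem_span_singleton]
  refine ⟨q, ?_⟩
  by_contra hne
  refine Nat.find_min hex (m := (QuadraticAlgebra.norm (w - z * q)).natAbs) ?_
    ⟨_, sub_mem hw (I.mul_mem_right _ hz), sub_ne_zero.2 hne, rfl⟩
  rw [← hm]
  have := norm_nonneg' (w - z * q)
  omega

/-! ### Evaluation at a root of `x² - x + 1` -/

section Eval

variable {n : ℕ} {a : ZMod n}

/-- The ring homomorphism `ℤ[ρ] → ℤ_n` with `ρ ↦ a`. -/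
noncomputable def evalHom (ha : a ^ 2 - a + 1 = 0) : EJInt →+* ZMod n :=
  (QuadraticAlgebra.lift (R := ℤ) (a := -1) (b := 1) (A := ZMod n)
    ⟨a, by simp; linear_combination ha⟩).toRingHom

theorem evalHom_apply (ha : a ^ 2 - a + 1 = 0) (z : EJInt) :
    evalHom ha z = z.re + z.im * a := by
  simp [evalHom, QuadraticAlgebra.lift]

theorem evalHom_rho (ha : a ^ 2 - a + 1 = 0) : evalHom ha rho = a := by
  rw [evalHom_apply]; simp [rho]

theorem evalHom_surjective (ha : a ^ 2 - a + 1 = 0) : Function.Surjective (evalHom ha) := by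
  intro x
  obtain ⟨m, rfl⟩ := ZMod.intCast_surjective x
  exact ⟨⟨m, 0⟩, by rw [evalHom_apply]; simp⟩

theorem frobGraph_eq_hexCayley (ha : a ^ 2 - a + 1 = 0) : frobGraph a = hexCayley (evalHom ha) := by
  have h2 : a ^ 2 = a - 1 := by linear_combination ha
  simp only [frobGraph, TL, hexCayley]
  congr 1
  simp only [Set.image_insert_eq, Set.image_singleton, map_neg, map_pow, map_one, evalHom_rho, h2]
  ext x
  simp only [Set.mem_insert_iff, Set.mem_singleton_iff]
  tauto

theorem frobGraph_one_sub : frobGraph (1 - a) = frobGraph a := by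
  simp only [frobGraph, TL]
  congr 1
  ext x
  simp only [Set.mem_insert_iff, Set.mem_singleton_iff]
  rw [show 1 - a - 1 = -a by ring, show -(1 - a) = a - 1 by ring, show -(a - 1) = 1 - a by ring,
    neg_neg]
  tauto

theorem natCast_dvd_norm_of_evalHom_eq_zero (ha : a ^ 2 - a + 1 = 0) {z : EJInt}
    (hz : evalHom ha z = 0) : (n : ℤ) ∣ QuadraticAlgebra.norm z := by
  rw [← ZMod.intCast_zmod_eq_zero_iff_dvd]
  have h : evalHom ha (z * star z) = 0 := by rw [map_mul, hz, zero_mul]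
  rw [← QuadraticAlgebra.algebraMap_norm_eq_mul_star, evalHom_apply] at h
  simpa using h

/-- A nonzero kernel element has norm divisible by `n`, hence at least `n`, whereas the norm is at
most the square of the hexagonal norm. -/
theorem evalHom_ne_zero (ha : a ^ 2 - a + 1 = 0) {z : EJInt} (hz : z ≠ 0)
    (h : hexNorm z ^ 2 < n) : evalHom ha z ≠ 0 := by
  intro h0
  have h1 := Int.le_of_dvd (norm_pos_of_ne_zero hz) (natCast_dvd_norm_of_evalHom_eq_zero ha h0)
  have h2 := norm_le_hexNorm_sq z
  have h3 : ((hexNorm z ^ 2 : ℕ) : ℤ) < n := by exact_mod_cast h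
  push_cast at h3
  linarith

theorem exists_generator_ker [NeZero n] (ha : a ^ 2 - a + 1 = 0) :
    ∃ i j : ℕ, i.Coprime j ∧ i ^ 2 + i * j + j ^ 2 = n ∧
      ∀ z, evalHom ha z = 0 ↔ ∃ w, z = (⟨(i : ℤ), (j : ℤ)⟩ : EJInt) * w := by
  have hbot : RingHom.ker (evalHom ha) ≠ ⊥ := by
    intro h
    have hmem : (⟨n, 0⟩ : EJInt) ∈ RingHom.ker (evalHom ha) := by
      rw [RingHom.mem_ker, evalHom_apply]; simp
    rw [h, Ideal.mem_bot, QuadraticAlgebra.ext_iff] at hmem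
    exact NeZero.ne n (by simpa using hmem.1)
  obtain ⟨z, hz0, hz⟩ := exists_generator _ hbot
  obtain ⟨k, hk, i, j, -, -, e⟩ := exists_sector hz0
  have hker : ∀ y, evalHom ha y = 0 ↔ ∃ w, y = (⟨(i : ℤ), (j : ℤ)⟩ : EJInt) * w := by
    intro y
    rw [← RingHom.mem_ker, hz, Ideal.mem_span_singleton]
    constructor
    · rintro ⟨w, rfl⟩
      exact ⟨rho ^ k * w, by rw [e]; ring⟩
    · rintro ⟨w, rfl⟩
      refine ⟨rho ^ (6 - k) * w, ?_⟩
      rw [e]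
      have := rho_pow_mul_cancel hk.le (⟨(i : ℤ), (j : ℤ)⟩ * w)
      rw [← this]; ring
  have hn : i ^ 2 + i * j + j ^ 2 = n := by
    have h1 := Nat.card_congr (RingHom.quotientKerEquivOfSurjective (evalHom_surjective ha)).toEquiv
    rw [hz, card_quotient_span z hz0, Nat.card_zmod, e, map_mul, map_pow, rho, norm_mk, norm_mk] at h1
    rw [← h1]
    zify
    rw [abs_of_nonneg (by positivity)]
    norm_num
  refine ⟨i, j, ?_, hn, hker⟩
  -- Primitivity: with `g` the gcd, the generator times the conjugate of its primitive part is the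
  -- integer `n / g`. It lies in the kernel, so `n` divides `n / g` and `g = 1`.
  obtain ⟨i', hi⟩ := Nat.gcd_dvd_left i j
  obtain ⟨j', hj⟩ := Nat.gcd_dvd_right i j
  rw [Nat.coprime_iff_gcd_eq_one]
  set g := i.gcd j with hg
  have hN : g * (g * (i' ^ 2 + i' * j' + j' ^ 2)) = n := by
    rw [← hn]; conv_rhs => rw [hi, hj]
    ring
  have h0 : evalHom ha ⟨((g * (i' ^ 2 + i' * j' + j' ^ 2) : ℕ) : ℤ), 0⟩ = 0 := by
    rw [hker]
    refine ⟨star ⟨(i' : ℤ), (j' : ℤ)⟩, ?_⟩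
    conv_rhs => rw [hi, hj]
    ext
    · simp; ring
    · simp; ring
  rw [evalHom_apply] at h0
  simp only [Int.cast_natCast, Int.cast_zero, zero_mul, add_zero] at h0
  rw [ZMod.natCast_eq_zero_iff] at h0
  have hpos : 0 < g * (i' ^ 2 + i' * j' + j' ^ 2) := by
    rcases Nat.eq_zero_or_pos (g * (i' ^ 2 + i' * j' + j' ^ 2)) with h | h
    · rw [h, mul_zero] at hN; exact absurd hN.symm (NeZero.ne n)
    · exact h
  have h1 := Nat.le_of_dvd hpos h0
  rw [← hN] at h1
  have hg0 : 0 < g := Nat.pos_of_mul_pos_right hpos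
  nlinarith

theorem evalHom_one_sub (ha : a ^ 2 - a + 1 = 0) (hb : (1 - a) ^ 2 - (1 - a) + 1 = 0) (z : EJInt) :
    evalHom hb z = evalHom ha (star z) := by
  rw [evalHom_apply, evalHom_apply]; simp; ring

/-- The other root `1 - a` defines the same graph, and its evaluation is the conjugate one;
conjugation swaps the coordinates of the generator up to a unit, so they can be ordered. -/
theorem exists_ordered_generator [NeZero n] (ha : a ^ 2 - a + 1 = 0) :
    ∃ (b : ZMod n) (hb : b ^ 2 - b + 1 = 0), frobGraph b = frobGraph a ∧
      ∃ c d : ℕ, d ≤ c ∧ c.Coprime d ∧ c ^ 2 + c * d + d ^ 2 = n ∧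
        ∀ z, evalHom hb z = 0 ↔ ∃ w, z = (⟨(c : ℤ), (d : ℤ)⟩ : EJInt) * w := by
  obtain ⟨i, j, hcop, hn, hker⟩ := exists_generator_ker ha
  rcases le_total j i with h | h
  · exact ⟨a, ha, rfl, i, j, h, hcop, hn, hker⟩
  have hb : (1 - a) ^ 2 - (1 - a) + 1 = 0 := by linear_combination ha
  refine ⟨1 - a, hb, frobGraph_one_sub, j, i, h, hcop.symm, by rw [← hn]; ring, fun z => ?_⟩
  rw [evalHom_one_sub ha hb, hker]
  have key : star (⟨(j : ℤ), (i : ℤ)⟩ : EJInt) = ⟨(i : ℤ), (j : ℤ)⟩ * star rho := by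
    ext
    · simp [rho]; ring
    · simp [rho]
  have hr : star rho * rho = 1 := by ext <;> simp [rho] <;> rfl
  constructor
  · rintro ⟨w, hw⟩
    refine ⟨star rho * star w, ?_⟩
    apply star_injective
    rw [hw, star_mul', key, star_mul', star_star, star_star]
    linear_combination (-(⟨(i : ℤ), (j : ℤ)⟩ : EJInt) * w) * hr
  · rintro ⟨w, rfl⟩
    exact ⟨star rho * star w, by rw [star_mul', key]; ring⟩

/-- Isomorphic quotients give isomorphic Cayley graphs. -/
def hexCayleyIso {A B : Type*} [CommRing A] [CommRing B] {f : EJInt →+* A} {g : EJInt →+* B}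
    (φ : A ≃+* B) (h : ∀ z, φ (f z) = g z) : hexCayley f ≃g hexCayley g where
  toEquiv := φ.toEquiv
  map_rel_iff' := by
    intro x y
    rw [hexCayley_adj, hexCayley_adj]
    change φ x ≠ φ y ∧ (∃ k, φ y = φ x + g rho ^ k) ↔ _
    refine and_congr φ.injective.ne_iff (exists_congr fun k => ?_)
    rw [← h rho, ← map_pow, ← map_add]
    exact φ.injective.eq_iff

theorem EJGraph_eq_hexCayley (z : EJInt) :
    EJGraph z = hexCayley (Ideal.Quotient.mk (Ideal.span {z})) := rfl

theorem exists_iso_EJGraph [NeZero n] (ha : a ^ 2 - a + 1 = 0) :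
    ∃ c d : ℕ, d ≤ c ∧ Nat.Coprime c d ∧ c ^ 2 + c * d + d ^ 2 = n ∧
      Nonempty (frobGraph a ≃g EJGraph ⟨(c : ℤ), (d : ℤ)⟩) := by
  obtain ⟨b, hb, hab, c, d, hdc, hcop, hn, hker⟩ := exists_ordered_generator ha
  refine ⟨c, d, hdc, hcop, hn, ?_⟩
  have hI : RingHom.ker (evalHom hb) = Ideal.span {(⟨(c : ℤ), (d : ℤ)⟩ : EJInt)} := by
    ext z
    rw [RingHom.mem_ker, hker, Ideal.mem_span_singleton]; rfl
  rw [← hab, frobGraph_eq_hexCayley hb, EJGraph_eq_hexCayley, ← hI]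
  exact ⟨(hexCayleyIso (RingHom.quotientKerEquivOfSurjective (evalHom_surjective hb))
    (fun z => rfl)).symm⟩

end Eval

/-! ### Basic properties of the circulant graphs -/

section Basic

variable {n : ℕ} {a : ZMod n} (ha : a ^ 2 - a + 1 = 0)
include ha

theorem root_pow_three : a ^ 3 = -1 := by linear_combination (a + 1) * ha

theorem root_pow_six : a ^ 6 = 1 := by
  rw [show 6 = 3 * 2 from rfl, pow_mul, root_pow_three ha]; norm_num

theorem root_pow_mod (k : ℕ) : a ^ k = a ^ (k % 6) := by
  conv_lhs => rw [← Nat.div_add_mod k 6, pow_add, pow_mul, root_pow_six ha, one_pow, one_mul]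

theorem exists_root_pow_inv (k : ℕ) : ∃ l, a ^ k * a ^ l = 1 :=
  ⟨5 * k, by rw [← pow_add, show k + 5 * k = 6 * k by ring, pow_mul, root_pow_six ha, one_pow]⟩

theorem isUnit_root_pow (k : ℕ) : IsUnit (a ^ k) := by
  obtain ⟨l, hl⟩ := exists_root_pow_inv ha k
  exact IsUnit.of_mul_eq_one _ hl

theorem frobGraph_adj (hn : 1 < n) {x y : ZMod n} :
    (frobGraph a).Adj x y ↔ ∃ k, y = x + a ^ k := by
  have : Fact (1 < n) := ⟨hn⟩
  rw [frobGraph_eq_hexCayley ha, hexCayley_adj, evalHom_rho]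
  refine and_iff_right_of_imp ?_
  rintro ⟨k, rfl⟩ h
  exact (isUnit_root_pow ha k).ne_zero (by simpa using h)

theorem frobGraph_connected : (frobGraph a).Connected := by
  rw [frobGraph_eq_hexCayley ha]; exact hexCayley_connected (evalHom_surjective ha)

theorem frobGraph_dist_le_diam [NeZero n] (x y : ZMod n) :
    (frobGraph a).dist x y ≤ (frobGraph a).diam :=
  dist_le_diam (connected_iff_ediam_ne_top.1 (frobGraph_connected ha))

theorem frobGraph_dist_eq (x y : ZMod n) :
    (frobGraph a).dist x y = (frobGraph a).dist 0 (y - x) := by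
  rw [frobGraph_eq_hexCayley ha]; exact hexCayley_dist_eq _ x y

theorem exists_dist_zero_eq_diam : ∃ x, (frobGraph a).dist 0 x = (frobGraph a).diam := by
  obtain ⟨u, v, h⟩ := (frobGraph a).exists_dist_eq_diam
  exact ⟨v - u, by rw [← h, frobGraph_dist_eq ha u v]⟩

theorem frobGraph_dist_evalHom_le (z : EJInt) :
    (frobGraph a).dist 0 (evalHom ha z) ≤ hexNorm z := by
  rw [frobGraph_eq_hexCayley ha]; exact hexCayley_dist_le _ z

theorem frobGraph_dist_mul_root_pow (x : ZMod n) (k : ℕ) :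
    (frobGraph a).dist 0 (x * a ^ k) = (frobGraph a).dist 0 x := by
  have key : ∀ x k, (frobGraph a).dist 0 (x * a ^ k) ≤ (frobGraph a).dist 0 x := by
    intro x k
    rw [frobGraph_eq_hexCayley ha]
    obtain ⟨z, rfl, hz⟩ := exists_hexNorm_eq_dist (evalHom_surjective ha) x
    rw [← hz, ← hexNorm_rho_pow_mul k z]
    refine le_trans (le_of_eq ?_) (hexCayley_dist_le (evalHom ha) _)
    rw [map_mul, map_pow, evalHom_rho, mul_comm]
  refine le_antisymm (key x k) ?_
  obtain ⟨l, hl⟩ := exists_root_pow_inv ha k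
  have := key (x * a ^ k) l
  rwa [mul_assoc, hl, mul_one] at this

theorem cellLabel_eq_evalHom (p : ℕ × ℕ) : cellLabel a p = evalHom ha ⟨(p.1 : ℤ), (p.2 : ℤ)⟩ := by
  rw [evalHom_apply]; simp [cellLabel]

theorem dist_cellLabel_le (p : ℕ × ℕ) : (frobGraph a).dist 0 (cellLabel a p) ≤ p.1 + p.2 := by
  rw [cellLabel_eq_evalHom ha]
  refine (frobGraph_dist_evalHom_le ha _).trans ?_
  simp only [hexNorm]; omega

/-- A shortest lift of `x`, rotated into the sector, is a cell whose level is exactly the distance.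
-/
theorem exists_cell {x : ZMod n} (hx : x ≠ 0) :
    ∃ p : ℕ × ℕ, 1 ≤ p.1 ∧ p.1 + p.2 = (frobGraph a).dist 0 x ∧ x ∈ orbitH a (cellLabel a p) := by
  obtain ⟨z, rfl, hz⟩ := exists_hexNorm_eq_dist (evalHom_surjective ha) x
  obtain ⟨k, -, i, j, hi, hij, e⟩ := exists_sector (z := z) (by rintro rfl; simp at hx)
  refine ⟨(i, j), hi, ?_, k, ?_⟩
  · rw [frobGraph_eq_hexCayley ha, ← hz]; exact hij
  · conv_lhs => rw [e]
    rw [map_mul, map_pow, evalHom_rho, cellLabel_eq_evalHom ha]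

theorem orbitH_symm {x y : ZMod n} (h : x ∈ orbitH a y) : y ∈ orbitH a x := by
  obtain ⟨k, rfl⟩ := h
  obtain ⟨l, hl⟩ := exists_root_pow_inv ha k
  exact ⟨l, by rw [← mul_assoc, mul_comm (a ^ l), hl, one_mul]⟩

end Basic

theorem orbitH_trans {n : ℕ} {a x y z : ZMod n} (h : x ∈ orbitH a y) (h' : y ∈ orbitH a z) :
    x ∈ orbitH a z := by
  obtain ⟨k, rfl⟩ := h
  obtain ⟨l, rfl⟩ := h'
  exact ⟨k + l, by rw [pow_add, mul_assoc]⟩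

theorem self_mem_orbitH {n : ℕ} (a x : ZMod n) : x ∈ orbitH a x := ⟨0, by simp⟩

/-! ### The greedy construction -/

/-- The order in which the cells are examined. -/
def Earlier (q p : ℕ × ℕ) : Prop := q.1 + q.2 < p.1 + p.2 ∨ (q.1 + q.2 = p.1 + p.2 ∧ q.2 < p.2)

/-- `C` is the outcome of examining the cells of `S`. -/
structure IsGreedy {n : ℕ} (a : ZMod n) (C S : Set (ℕ × ℕ)) : Prop where
  subset : C ⊆ S
  covered_eq : covered a C = covered a S
  not_mem : ∀ p ∈ C, ∀ q ∈ S, Earlier q p → cellLabel a p ∉ orbitH a (cellLabel a q)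

theorem mem_covered {n : ℕ} {a x : ZMod n} {C : Set (ℕ × ℕ)} :
    x ∈ covered a C ↔ ∃ p ∈ C, x ∈ orbitH a (cellLabel a p) := by
  simp [covered]

theorem covered_insert {n : ℕ} (a : ZMod n) (C : Set (ℕ × ℕ)) (p : ℕ × ℕ) :
    covered a (insert p C) = orbitH a (cellLabel a p) ∪ covered a C := by
  rw [covered, Set.biUnion_insert]; rfl

/-- Since cells are examined in increasing order, a new cell is never earlier than an old one. It is
rejected precisely when covered, so an accepted label cannot lie in the orbit of an earlier label.
-/
theorem IsGreedy.examine {n : ℕ} {a : ZMod n} {C S : Set (ℕ × ℕ)} (h : IsGreedy a C S)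
    {p : ℕ × ℕ} (hp : ∀ q ∈ S, Earlier q p) : IsGreedy a (examine a C p) (insert p S) := by
  rw [FrobeniusCirculant.examine]
  split_ifs with hc
  · refine ⟨h.subset.trans (Set.subset_insert _ _), ?_, ?_⟩
    · rw [covered_insert, ← h.covered_eq, Set.union_eq_self_of_subset_left hc]
    · intro p' hp' q hq hqp
      rcases hq with rfl | hq
      · have := hp p' (h.subset hp')
        simp only [Earlier] at this hqp; omega
      · exact h.not_mem p' hp' q hq hqp
  · refine ⟨Set.insert_subset_insert h.subset, ?_, ?_⟩
    · rw [covered_insert, covered_insert, h.covered_eq]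
    · intro p' hp' q hq hqp
      rcases hp' with rfl | hp'
      · rcases hq with rfl | hq
        · simp only [Earlier] at hqp; omega
        · intro hm
          refine hc fun x hx => ?_
          rw [h.covered_eq, mem_covered]
          exact ⟨q, hq, orbitH_trans hx hm⟩
      · rcases hq with rfl | hq
        · have := hp p' (h.subset hp')
          simp only [Earlier] at this hqp; omega
        · exact h.not_mem p' hp' q hq hqp

/-- The first-sector cells up to level `m`. -/
def cellsUpTo (m : ℕ) : Set (ℕ × ℕ) := {p | 1 ≤ p.1 ∧ p.1 + p.2 ≤ m}

theorem IsGreedy.examineLevel {n : ℕ} {a : ZMod n} {C : Set (ℕ × ℕ)} {m : ℕ}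
    (h : IsGreedy a C (cellsUpTo m)) :
    IsGreedy a (examineLevel a C (m + 1)) (cellsUpTo (m + 1)) := by
  have key : ∀ l ≤ m + 1,
      IsGreedy a (((List.range l).map fun j => (m + 1 - j, j)).foldl (FrobeniusCirculant.examine a) C)
        {p | 1 ≤ p.1 ∧ (p.1 + p.2 ≤ m ∨ (p.1 + p.2 = m + 1 ∧ p.2 < l))} := by
    intro l hl
    induction l with
    | zero =>
      convert! h using 1
      ext p; simp [cellsUpTo]
    | succ l ih =>
      rw [List.range_succ, List.map_append, List.foldl_append]
      simp only [List.map_cons, List.map_nil, List.foldl_cons, List.foldl_nil]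
      convert! (ih (by omega)).examine (p := (m + 1 - l, l)) ?_ using 1
      · ext ⟨i, j⟩
        simp only [Set.mem_ofPred_eq, Set.mem_insert_iff, Prod.mk.injEq]
        omega
      · rintro ⟨i, j⟩ hq
        simp only [Set.mem_ofPred_eq, Earlier] at hq ⊢
        omega
  convert! key (m + 1) le_rfl using 1
  ext ⟨i, j⟩
  simp only [cellsUpTo, Set.mem_ofPred_eq]
  omega

theorem subset_examine {n : ℕ} (a : ZMod n) (C : Set (ℕ × ℕ)) (p : ℕ × ℕ) :
    C ⊆ examine a C p := by
  rw [examine]; split_ifs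
  · exact subset_rfl
  · exact Set.subset_insert _ _

theorem subset_examineLevel {n : ℕ} (a : ZMod n) (C : Set (ℕ × ℕ)) (l : ℕ) :
    C ⊆ examineLevel a C l := by
  rw [examineLevel]
  generalize (List.range l).map (fun j => (l - j, j)) = L
  induction L generalizing C with
  | nil => exact subset_rfl
  | cons p L ih => exact (subset_examine a C p).trans (ih _)

theorem diagramCells_mono {n : ℕ} (a : ZMod n) : Monotone (diagramCells a) := by
  refine monotone_nat_of_le_succ fun m => ?_
  rw [diagramCells]
  split_ifs
  · exact le_rfl
  · exact subset_examineLevel _ _ _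

/-! ### The completed diagram: true distances, predecessors and orbit representatives -/

section Sector

variable {n : ℕ} [NeZero n] {a : ZMod n} (ha : a ^ 2 - a + 1 = 0) (hn : 1 < n)
include ha hn

theorem diam_pos : 0 < (frobGraph a).diam := by
  have : Fact (1 < n) := ⟨hn⟩
  exact ((frobGraph_connected ha).pos_dist_of_ne zero_ne_one).trans_le
    (frobGraph_dist_le_diam ha 0 1)

/-- The final diagram is the outcome of examining all cells up to the diameter. -/
theorem isGreedy_iUnion : IsGreedy a (⋃ m, diagramCells a m) (cellsUpTo (frobGraph a).diam) := by
  have hpos := diam_pos ha hn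
  have key : ∀ m < (frobGraph a).diam, IsGreedy a (diagramCells a m) (cellsUpTo (m + 1)) := by
    intro m hm
    induction m with
    | zero =>
      have : cellsUpTo (0 + 1) = {((1, 0) : ℕ × ℕ)} := by
        ext ⟨i, j⟩
        simp only [cellsUpTo, Set.mem_ofPred_eq, Set.mem_singleton_iff, Prod.mk.injEq]
        omega
      rw [this, diagramCells]
      refine ⟨subset_rfl, rfl, ?_⟩
      rintro p rfl q rfl hqp
      simp [Earlier] at hqp
    | succ m ih =>
      have h := ih (by omega)
      rw [diagramCells, if_neg]
      · exact h.examineLevel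
      · intro hcov
        -- The procedure cannot stop early: an element at distance equal to the diameter is not
        -- covered by cells of lower level.
        obtain ⟨x, hx⟩ := exists_dist_zero_eq_diam ha
        have hx0 : x ≠ 0 := by rintro rfl; simp at hx; omega
        have := hcov (show x ∈ ({0}ᶜ : Set (ZMod n)) from hx0)
        rw [h.covered_eq, mem_covered] at this
        obtain ⟨p, hp, k, rfl⟩ := this
        rw [mul_comm, frobGraph_dist_mul_root_pow ha] at hx
        have h1 := dist_cellLabel_le ha p
        have h2 := hp.2
        omega
  have hlast := key ((frobGraph a).diam - 1) (by omega)
  rw [Nat.sub_add_cancel hpos] at hlast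
  have hcov : ({0}ᶜ : Set (ZMod n)) ⊆ covered a (diagramCells a ((frobGraph a).diam - 1)) := by
    intro x hx
    rw [hlast.covered_eq, mem_covered]
    obtain ⟨p, h1, h2, h3⟩ := exists_cell ha (x := x) hx
    exact ⟨p, ⟨h1, h2 ▸ frobGraph_dist_le_diam ha 0 x⟩, h3⟩
  -- State `m` is the state after level `m + 1`, so everything is covered at index `diam - 1` and
  -- the states are constant from there on.
  have hst : ∀ k, diagramCells a ((frobGraph a).diam - 1 + k) =
      diagramCells a ((frobGraph a).diam - 1) := by
    intro k
    induction k with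
    | zero => rfl
    | succ k ih => rw [← Nat.add_assoc, diagramCells, ih, if_pos hcov]
  convert! hlast using 1
  refine Set.Subset.antisymm (Set.iUnion_subset fun m => ?_) (Set.subset_iUnion _ _)
  rw [← hst m]
  exact diagramCells_mono a (by omega)

variable (hD : (frobGraph a).diam ^ 2 < n)
include hD

omit hn [NeZero n] in
theorem evalHom_ne_zero_of_le_diam {z : EJInt} (hz : z ≠ 0) (h : hexNorm z ≤ (frobGraph a).diam) :
    evalHom ha z ≠ 0 :=
  evalHom_ne_zero ha hz (lt_of_le_of_lt (Nat.pow_le_pow_left h 2) hD)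

omit hn [NeZero n] in
theorem cellLabel_ne_zero {p : ℕ × ℕ} (hp : p ∈ cellsUpTo (frobGraph a).diam) :
    cellLabel a p ≠ 0 := by
  obtain ⟨h1, h2⟩ := hp
  rw [cellLabel_eq_evalHom ha]
  refine evalHom_ne_zero_of_le_diam ha hD ?_ ?_
  · intro h
    have := congrArg QuadraticAlgebra.re h
    simp at this; omega
  · simp only [hexNorm]; omega

/-- Were the distance smaller, a cell at the level of that distance would represent the same orbit
and, being earlier, would have excluded `p`. -/
theorem dist_cellLabel {p : ℕ × ℕ} (hp : p ∈ ⋃ m, diagramCells a m) :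
    (frobGraph a).dist 0 (cellLabel a p) = p.1 + p.2 := by
  have hg := isGreedy_iUnion ha hn
  refine le_antisymm (dist_cellLabel_le ha p) ?_
  by_contra! h
  obtain ⟨q, h1, h2, h3⟩ := exists_cell ha (cellLabel_ne_zero ha hD (hg.subset hp))
  refine hg.not_mem p hp q ⟨h1, ?_⟩ (Or.inl (by omega)) h3
  rw [h2]; exact frobGraph_dist_le_diam ha _ _

omit hD in
theorem exists_earlier {q : ℕ × ℕ} (hq : q ∈ cellsUpTo (frobGraph a).diam)
    (hq' : q ∉ ⋃ m, diagramCells a m) :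
    ∃ r : ℕ × ℕ, 1 ≤ r.1 ∧ Earlier r q ∧ cellLabel a q ∈ orbitH a (cellLabel a r) := by
  have hg := isGreedy_iUnion ha hn
  have hc : cellLabel a q ∈ covered a (cellsUpTo (frobGraph a).diam) :=
    mem_covered.2 ⟨q, hq, self_mem_orbitH _ _⟩
  rw [← hg.covered_eq, mem_covered] at hc
  obtain ⟨r, hr, hqr⟩ := hc
  refine ⟨r, (hg.subset hr).1, ?_, hqr⟩
  by_contra hne
  have hne' : r ≠ q := fun h => hq' (h ▸ hr)
  refine hg.not_mem r hr q hq ?_ (orbitH_symm ha hqr)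
  simp only [Earlier] at hne ⊢
  by_contra h
  exact hne' (Prod.ext (by omega) (by omega))

/-- If the lower neighbour `q` was rejected, its label is a rotate of an earlier cell `r`, and
adding the same generator rotates to `r + ρ ^ e`. Since `(i, j)` was accepted, this point can be
neither shorter nor an earlier cell. The few remaining configurations make `q - ρ ^ m r` a nonzero
kernel element of norm at most the diameter. -/
theorem exists_parent_cell {i j : ℕ} (hp : (i, j) ∈ ⋃ m, diagramCells a m) (hij : 2 ≤ i + j) :
    ∃ s q, q ∈ ⋃ m, diagramCells a m ∧ q.1 + q.2 + 1 = i + j ∧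
      cellLabel a (i, j) = cellLabel a q + a ^ s := by
  have hg := isGreedy_iUnion ha hn
  obtain ⟨hi, hle⟩ := hg.subset hp
  simp only at hi hle
  have hdist := dist_cellLabel ha hn hD hp
  simp only at hdist
  -- the consequences of a neighbour of the cell not being in the diagram
  have key : ∀ q ∈ cellsUpTo (frobGraph a).diam, ∀ s ≤ 1, q.1 + q.2 + 1 = i + j → q.2 + s = j →
      cellLabel a (i, j) = cellLabel a q + a ^ s → q ∉ ⋃ m, diagramCells a m →
      ∃ m i' j', i' + j' + 1 = i + j ∧ j' < q.2 ∧
        evalHom ha (⟨(q.1 : ℤ), (q.2 : ℤ)⟩ - rho ^ m * ⟨(i' : ℤ), (j' : ℤ)⟩) = 0 ∧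
        ((m + 5 = s + 6 ∧ j' = 0) ∨ (s = 0 ∧ m = 5 ∧ j' + 1 = j)) := by
    intro q hq s hs hl hqj hlab hq'
    obtain ⟨r, hr1, hrq, k, hk⟩ := exists_earlier ha hn hq hq'
    rw [root_pow_mod ha] at hk
    have hk6 : k % 6 < 6 := Nat.mod_lt _ (by norm_num)
    generalize k % 6 = m at hk hk6
    -- The generator `a ^ s` is expressed relative to the rotation by `a ^ m`, with exponents taken
    -- modulo 6.
    obtain ⟨e, he6, he⟩ : ∃ e < 6, m + e = s ∨ m + e = s + 6 := by
      by_cases h : m ≤ s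
      · exact ⟨s - m, by omega, Or.inl (by omega)⟩
      · exact ⟨s + 6 - m, by omega, Or.inr (by omega)⟩
    have hae : a ^ s = a ^ m * a ^ e := by
      rw [← pow_add]
      rcases he with h | h
      · rw [h]
      · rw [h, pow_add, root_pow_six ha, mul_one]
    have hlab' : cellLabel a (i, j) =
        a ^ m * evalHom ha (⟨(r.1 : ℤ), (r.2 : ℤ)⟩ + rho ^ e) := by
      rw [hlab, hk, hae, map_add, map_pow, evalHom_rho, cellLabel_eq_evalHom ha r, mul_add]
    have hdle : ∀ z, cellLabel a (i, j) = a ^ m * evalHom ha z → i + j ≤ hexNorm z := by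
      intro z hz
      rw [← hdist, hz, mul_comm, frobGraph_dist_mul_root_pow ha]
      exact frobGraph_dist_evalHom_le ha z
    have hnot : ∀ i' j' : ℕ, 1 ≤ i' → i' + j' = i + j → j' < j →
        cellLabel a (i, j) ≠ a ^ m * evalHom ha ⟨(i' : ℤ), (j' : ℤ)⟩ := by
      intro i' j' h1 h2 h3 h4
      exact hg.not_mem (i, j) hp (i', j') ⟨h1, by simp only; omega⟩ (Or.inr ⟨h2, h3⟩)
        ⟨m, by rw [h4, cellLabel_eq_evalHom ha]⟩
    -- The label is at its true distance `i + j`, so `r + ρ ^ e` has at least this norm. As `r` is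
    -- earlier than `q`, it must lie on the level of `q`.
    have hbound := hdle _ hlab'
    have hlev : r.1 + r.2 + 1 = i + j := by
      have h1 := hexNorm_add_le ⟨(r.1 : ℤ), (r.2 : ℤ)⟩ (rho ^ e)
      rw [hexNorm_rho_pow] at h1
      have h2 : hexNorm ⟨(r.1 : ℤ), (r.2 : ℤ)⟩ = r.1 + r.2 := by simp only [hexNorm]; omega
      simp only [Earlier] at hrq
      omega
    have hrj : r.2 < q.2 := by simp only [Earlier] at hrq; omega
    have hker : evalHom ha (⟨(q.1 : ℤ), (q.2 : ℤ)⟩ - rho ^ m * ⟨(r.1 : ℤ), (r.2 : ℤ)⟩) = 0 := by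
      rw [map_sub, map_mul, map_pow, evalHom_rho, ← cellLabel_eq_evalHom ha,
        ← cellLabel_eq_evalHom ha, hk, sub_self]
    refine ⟨m, r.1, r.2, hlev, hrj, hker, ?_⟩
    have r4 : rho ^ 4 = (⟨0, -1⟩ : EJInt) := by
      rw [pow_succ', rho_cube, rho_mul]; rfl
    have r5 : rho ^ 5 = (⟨1, -1⟩ : EJInt) := by
      rw [pow_succ', r4, rho_mul]; rfl
    -- The norm of `r` rises only for `e = 0`, `e = 1`, or `e = 5` with `r` on the axis. For `e = 0,
    -- 1` the result is a cell earlier than `(i, j)`, except when `e = 1` and `r.2 + 1 = j`.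
    interval_cases e
    · refine absurd hlab' ?_
      rw [pow_zero]
      convert! hnot (r.1 + 1) r.2 (by omega) (by omega) (by omega) using 4
    · by_cases hlt : r.2 + 1 < j
      · refine absurd hlab' ?_
        rw [pow_one]
        convert! hnot r.1 (r.2 + 1) (by omega) (by omega) hlt using 4
      · right; omega
    · rw [rho_sq] at hbound
      simp only [hexNorm, QuadraticAlgebra.re_add, QuadraticAlgebra.im_add, le_max_iff] at hbound
      omega
    · rw [rho_cube] at hbound
      simp only [hexNorm, QuadraticAlgebra.re_add, QuadraticAlgebra.im_add, QuadraticAlgebra.re_neg,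
        QuadraticAlgebra.im_neg, QuadraticAlgebra.re_one, QuadraticAlgebra.im_one,
        le_max_iff] at hbound
      omega
    · rw [r4] at hbound
      simp only [hexNorm, QuadraticAlgebra.re_add, QuadraticAlgebra.im_add, le_max_iff] at hbound
      omega
    · rw [r5] at hbound
      simp only [hexNorm, QuadraticAlgebra.re_add, QuadraticAlgebra.im_add, le_max_iff] at hbound
      left; omega
  have hne : ∀ x y : ℤ, (x ≠ 0 ∨ y ≠ 0) → x.natAbs ≤ i + j → y.natAbs ≤ i + j →
      (x + y).natAbs ≤ i + j → evalHom ha ⟨x, y⟩ ≠ 0 := by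
    intro x y h0 h1 h2 h3
    refine evalHom_ne_zero_of_le_diam ha hD ?_ ?_
    · intro h
      rw [QuadraticAlgebra.ext_iff] at h
      simp at h
      tauto
    · simp only [hexNorm]; omega
  have r5 : ∀ z, rho ^ 5 * z = (⟨z.re + z.im, -z.re⟩ : EJInt) := by
    intro z
    rw [show rho ^ 5 = rho ^ 3 * (rho * rho) from by ring, rho_cube, mul_assoc, mul_assoc, rho_mul,
      rho_mul]
    ext <;> simp
  -- The predecessor is `(i - 1, j)` when this stays in the half-open sector; otherwise `i = 1` and
  -- it is `(1, j - 1)`.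
  rcases Nat.lt_or_ge 1 i with h2 | h2
  · refine ⟨0, (i - 1, j), ?_, by simp only; omega, ?_⟩
    swap
    · simp only [cellLabel, pow_zero]
      rw [Nat.cast_sub hi]; push_cast; ring
    by_contra hq'
    obtain ⟨m, i', j', h3, h4, h5, h6⟩ := key (i - 1, j) ⟨by simp only; omega, by simp only; omega⟩ 0
      (by omega) (by simp only; omega) rfl (by
        simp only [cellLabel, pow_zero]
        rw [Nat.cast_sub hi]; push_cast; ring) hq'
    rcases h6 with ⟨hm, rfl⟩ | ⟨-, rfl, hj⟩
    · obtain rfl : m = 1 := by omega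
      rw [pow_one, rho_mul] at h5
      exact hne (((i - 1 : ℕ) : ℤ) - -((0 : ℕ) : ℤ)) ((j : ℤ) - ((i' : ℤ) + ((0 : ℕ) : ℤ)))
        (by omega) (by omega) (by omega) (by omega) h5
    · rw [r5] at h5
      exact hne (((i - 1 : ℕ) : ℤ) - ((i' : ℤ) + (j' : ℤ))) ((j : ℤ) - -(i' : ℤ))
        (by omega) (by omega) (by omega) (by omega) h5
  · obtain rfl : i = 1 := by omega
    refine ⟨1, (1, j - 1), ?_, by simp only; omega, ?_⟩
    swap
    · simp only [cellLabel, pow_one]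
      rw [Nat.cast_sub (by omega)]; push_cast; ring
    by_contra hq'
    obtain ⟨m, i', j', h3, h4, h5, h6⟩ := key (1, j - 1) ⟨by simp only; omega, by simp only; omega⟩ 1
      (by omega) (by simp only; omega) (by simp only; omega) (by
        simp only [cellLabel, pow_one]
        rw [Nat.cast_sub (by omega)]; push_cast; ring) hq'
    rcases h6 with ⟨hm, rfl⟩ | ⟨h0, -, -⟩
    · obtain rfl : m = 2 := by omega
      rw [pow_two, mul_assoc, rho_mul, rho_mul] at h5
      exact hne (((1 : ℕ) : ℤ) - -((i' : ℤ) + ((0 : ℕ) : ℤ)))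
        (((j - 1 : ℕ) : ℤ) - (-((0 : ℕ) : ℤ) + ((i' : ℤ) + ((0 : ℕ) : ℤ))))
        (by omega) (by omega) (by omega) (by omega) h5
    · omega

/-- A parent function exists. -/
theorem exists_isParentChoice : ∃ p, IsParentChoice a p := by
  have h : ∀ v ∈ sectorY a, ∃ u, u ∈ insert 0 (sectorY a) ∧ (frobGraph a).Adj u v ∧
      (frobGraph a).dist 0 u + 1 = (frobGraph a).dist 0 v := by
    rintro v ⟨⟨i, j⟩, hp, rfl⟩
    have hdist := dist_cellLabel ha hn hD hp
    have hi := ((isGreedy_iUnion ha hn).subset hp).1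
    simp only at hi hdist
    rcases Nat.lt_or_ge (i + j) 2 with h2 | h2
    · obtain ⟨rfl, rfl⟩ : i = 1 ∧ j = 0 := by omega
      refine ⟨0, Set.mem_insert _ _, (frobGraph_adj ha hn).2 ⟨0, by simp [cellLabel]⟩, ?_⟩
      rw [hdist]; simp
    · obtain ⟨s, q, hq, hl, he⟩ := exists_parent_cell ha hn hD hp h2
      refine ⟨cellLabel a q, Set.mem_insert_of_mem _ ⟨q, hq, rfl⟩,
        (frobGraph_adj ha hn).2 ⟨s, he⟩, ?_⟩
      rw [hdist, dist_cellLabel ha hn hD hq, hl]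
  choose! p hp using h
  exact ⟨p, hp⟩

theorem zero_notMem_sectorY : (0 : ZMod n) ∉ sectorY a := by
  rintro ⟨p, hp, h⟩
  exact cellLabel_ne_zero ha hD ((isGreedy_iUnion ha hn).subset hp) h

omit hD in
theorem exists_mem_sectorY {x : ZMod n} (hx : x ≠ 0) : ∃ v ∈ sectorY a, ∃ k < 6, x = v * a ^ k := by
  have hg := isGreedy_iUnion ha hn
  obtain ⟨p, h1, h2, h3⟩ := exists_cell ha hx
  have : x ∈ covered a (cellsUpTo (frobGraph a).diam) :=
    mem_covered.2 ⟨p, ⟨h1, h2 ▸ frobGraph_dist_le_diam ha 0 x⟩, h3⟩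
  rw [← hg.covered_eq, mem_covered] at this
  obtain ⟨q, hq, k, hk⟩ := this
  exact ⟨_, ⟨q, hq, rfl⟩, k % 6, Nat.mod_lt _ (by norm_num), by
    rw [hk, mul_comm, ← root_pow_mod ha]⟩

omit hD in
-- Different cells are comparable in the examination order, and the later one would not have been
-- accepted in the orbit of the earlier.
theorem eq_of_mem_sectorY {v w : ZMod n} (hv : v ∈ sectorY a) (hw : w ∈ sectorY a) {k : ℕ}
    (h : w = v * a ^ k) : w = v := by
  have hg := isGreedy_iUnion ha hn
  obtain ⟨p, hp, rfl⟩ := hv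
  obtain ⟨q, hq, rfl⟩ := hw
  have hqp : cellLabel a q ∈ orbitH a (cellLabel a p) := ⟨k, by rw [h, mul_comm]⟩
  by_cases hne : p = q
  · rw [hne]
  exfalso
  have : Earlier p q ∨ Earlier q p := by
    by_contra h
    simp only [Earlier] at h
    exact hne (Prod.ext (by omega) (by omega))
  rcases this with h1 | h1
  · exact hg.not_mem q hq p (hg.subset hp) h1 hqp
  · exact hg.not_mem p hp q (hg.subset hq) h1 (orbitH_symm ha hqp)

end Sector

/-! ### Uniform shortest path routings attain the forwarding indices -/

section Load

variable {V : Type*} [Fintype V] [DecidableEq V] {G : SimpleGraph V}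

theorem sum_count_eq_length {α : Type*} [Fintype α] [DecidableEq α] (l : List α) :
    ∑ x, l.count x = l.length := by
  induction l with
  | nil => simp
  | cons y l ih =>
    simp only [List.count_cons, Finset.sum_add_distrib, ih, List.length_cons]
    simp

theorem sum_arcLoad [Fintype G.Dart] (R : Routing G) :
    ∑ d, arcLoad R d = ∑ u, ∑ v, (R u v).1.length := by
  simp only [arcLoad]
  rw [Finset.sum_comm]
  refine Finset.sum_congr rfl fun u _ => ?_
  rw [Finset.sum_comm]
  refine Finset.sum_congr rfl fun v _ => ?_
  rw [sum_count_eq_length, Walk.length_darts]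

theorem edgeLoad_edge (R : Routing G) (d : G.Dart) :
    edgeLoad R d.edge = arcLoad R d + arcLoad R d.symm := by
  have key : ∀ l : List G.Dart,
      (l.map Dart.edge).count d.edge = l.count d + l.count d.symm := by
    intro l
    induction l with
    | nil => rfl
    | cons e l ih =>
      rw [List.map_cons, List.count_cons, List.count_cons, List.count_cons, ih]
      have h := dart_edge_eq_iff e d
      have hne : d ≠ d.symm := fun h => d.symm_ne h.symm
      by_cases h1 : e = d
      · subst h1; simp [hne]; omega
      · by_cases h2 : e = d.symm
        · subst h2; simp [h1]; omega
        · have : e.edge ≠ d.edge := by simp [h, h1, h2]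
          simp [h1, h2, this]
  simp only [edgeLoad, arcLoad, ← Finset.sum_add_distrib]
  exact Finset.sum_congr rfl fun u _ => Finset.sum_congr rfl fun v _ => key _

theorem arcLoad_le_maxArcLoad (R : Routing G) (d : G.Dart) : arcLoad R d ≤ maxArcLoad R := by
  classical
  exact le_ciSup (f := arcLoad R) (Set.finite_range _).bddAbove d

theorem edgeLoad_le_maxEdgeLoad (R : Routing G) (e : G.edgeSet) :
    edgeLoad R e ≤ maxEdgeLoad R :=
  le_ciSup (f := fun e : G.edgeSet => edgeLoad R e) (Set.finite_range _).bddAbove e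

/-- Averaging: the arc loads sum to the total path length, and each edge load is the sum of its two
arc loads. -/
theorem sum_dist_le_card_mul [Fintype G.Dart] (R : Routing G) :
    ∑ u, ∑ v, G.dist u v ≤ Fintype.card G.Dart * maxArcLoad R ∧
      2 * ∑ u, ∑ v, G.dist u v ≤ Fintype.card G.Dart * maxEdgeLoad R := by
  have h0 : ∑ u, ∑ v, G.dist u v ≤ ∑ d, arcLoad R d := by
    rw [sum_arcLoad]
    exact Finset.sum_le_sum fun u _ => Finset.sum_le_sum fun v _ => dist_le _
  constructor
  · refine h0.trans ((Finset.sum_le_card_nsmul _ _ _ fun d _ => arcLoad_le_maxArcLoad R d).trans ?_)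
    simp
  · have h1 : 2 * ∑ d, arcLoad R d = ∑ d : G.Dart, edgeLoad R d.edge := by
      simp only [edgeLoad_edge, Finset.sum_add_distrib, two_mul]
      congr 1
      exact (Equiv.sum_comp (Function.Involutive.toPerm _ Dart.symm_involutive) _).symm
    refine (Nat.mul_le_mul_left 2 h0).trans (h1.le.trans ?_)
    refine (Finset.sum_le_card_nsmul _ _ _
      fun d _ => edgeLoad_le_maxEdgeLoad R ⟨d.edge, d.edge_mem⟩).trans ?_
    simp

variable {P : Routing G}

theorem IsArcUniform.isEdgeUniform (hu : IsArcUniform P) : IsEdgeUniform P := by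
  intro e he f hf
  induction e with | _ x y =>
  induction f with | _ x' y' =>
  have h1 := edgeLoad_edge P ⟨(x, y), he⟩
  have h2 := edgeLoad_edge P ⟨(x', y'), hf⟩
  rw [hu _ ⟨(x', y'), hf⟩, hu (Dart.symm _) (Dart.symm ⟨(x', y'), hf⟩), ← h2] at h1
  exact h1

theorem IsArcUniform.maxArcLoad_eq (hu : IsArcUniform P) (d : G.Dart) :
    maxArcLoad P = arcLoad P d := by
  have : Nonempty G.Dart := ⟨d⟩
  refine le_antisymm (ciSup_le fun e => (hu e d).le) (arcLoad_le_maxArcLoad P d)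

theorem IsArcUniform.maxEdgeLoad_eq (hu : IsArcUniform P) (d : G.Dart) :
    maxEdgeLoad P = 2 * arcLoad P d := by
  have : Nonempty G.edgeSet := ⟨⟨d.edge, d.edge_mem⟩⟩
  have h : edgeLoad P d.edge = 2 * arcLoad P d := by
    rw [edgeLoad_edge, hu d.symm d, two_mul]
  rw [← h]
  exact le_antisymm (ciSup_le fun e => (hu.isEdgeUniform _ e.2 _ d.edge_mem).le)
    (edgeLoad_le_maxEdgeLoad P ⟨d.edge, d.edge_mem⟩)

theorem card_mul_maxArcLoad [Fintype G.Dart] (hs : IsShortestPathRouting P) (hu : IsArcUniform P)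
    (d : G.Dart) : Fintype.card G.Dart * maxArcLoad P = ∑ u, ∑ v, G.dist u v := by
  rw [hu.maxArcLoad_eq d]
  have h := sum_arcLoad P
  rw [Finset.sum_congr rfl fun e _ => hu e d, Finset.sum_const, smul_eq_mul, Finset.card_univ] at h
  rw [h]
  exact Finset.sum_congr rfl fun u _ => Finset.sum_congr rfl fun v _ => hs u v

/-- A shortest path routing with the same load on all arcs attains all forwarding indices. -/
theorem forwarding_indices (hs : IsShortestPathRouting P) (hu : IsArcUniform P) (d : G.Dart) :
    maxEdgeLoad P = 2 * maxArcLoad P ∧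
    maxEdgeLoad P = edgeForwardingIndex G ∧ maxArcLoad P = arcForwardingIndex G ∧
      maxArcLoad P = minimalArcForwardingIndex G ∧
        maxEdgeLoad P = minimalEdgeForwardingIndex G := by
  classical
  have : Nonempty (Routing G) := ⟨P⟩
  have : Nonempty {R : Routing G // IsShortestPathRouting R} := ⟨⟨P, hs⟩⟩
  have hpos : 0 < Fintype.card G.Dart := Fintype.card_pos_iff.2 ⟨d⟩
  have h2 : maxEdgeLoad P = 2 * maxArcLoad P := by
    rw [hu.maxEdgeLoad_eq d, hu.maxArcLoad_eq d]
  have hc := card_mul_maxArcLoad hs hu d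
  have la : ∀ R : Routing G, maxArcLoad P ≤ maxArcLoad R := fun R =>
    Nat.le_of_mul_le_mul_left (hc.le.trans (sum_dist_le_card_mul R).1) hpos
  have le : ∀ R : Routing G, maxEdgeLoad P ≤ maxEdgeLoad R := fun R => by
    refine Nat.le_of_mul_le_mul_left ?_ hpos
    rw [h2, mul_left_comm, hc]
    exact (sum_dist_le_card_mul R).2
  exact ⟨h2, le_antisymm (le_ciInf le) (ciInf_le (OrderBot.bddBelow _) P),
    le_antisymm (le_ciInf la) (ciInf_le (OrderBot.bddBelow _) P),
    le_antisymm (le_ciInf fun R => la R.1)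
      (ciInf_le (f := fun R : {R : Routing G // IsShortestPathRouting R} => maxArcLoad R.1)
        (OrderBot.bddBelow _) ⟨P, hs⟩),
    le_antisymm (le_ciInf fun R => le R.1)
      (ciInf_le (f := fun R : {R : Routing G // IsShortestPathRouting R} => maxEdgeLoad R.1)
        (OrderBot.bddBelow _) ⟨P, hs⟩)⟩

/-- An automorphism carrying one arc to another permutes the ordered pairs of ends and their paths,
so it matches the traversals of the two arcs. -/
theorem IsArcTransitiveRouting.isArcUniform {A : Subgroup (Equiv.Perm V)}
    (h : IsArcTransitiveRouting A P) : IsArcUniform P := by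
  obtain ⟨h1, h2, h3⟩ := h
  rintro ⟨⟨x, y⟩, hxy⟩ ⟨⟨x', y'⟩, hxy'⟩
  obtain ⟨g, hg, rfl, rfl⟩ := h3 x y x' y' hxy hxy'
  let φ : G →g G := ⟨g, fun {u v} huv => (h1 g hg u v).2 huv⟩
  have hw : ∀ u v, (P (g u) (g v)).1 = (P u v).1.map φ := fun u v => by
    apply Walk.ext_support
    rw [← h2 g hg, Walk.support_map]; rfl
  have hinj : Function.Injective φ.mapDart := by
    rintro ⟨⟨u, v⟩, h⟩ ⟨⟨u', v'⟩, h'⟩ he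
    rw [Dart.ext_iff] at he ⊢
    have he' : (g u, g v) = (g u', g v') := he
    simpa using he'
  simp only [arcLoad]
  rw [← Equiv.sum_comp g fun u => ∑ v, (P u v).1.darts.count (⟨(g x, g y), hxy'⟩ : G.Dart)]
  refine Finset.sum_congr rfl fun u _ => ?_
  rw [← Equiv.sum_comp g fun v => (P (g u) v).1.darts.count (⟨(g x, g y), hxy'⟩ : G.Dart)]
  refine Finset.sum_congr rfl fun v _ => ?_
  rw [hw, Walk.darts_map]
  exact (List.count_map_of_injective _ _ hinj (⟨(x, y), hxy⟩ : G.Dart)).symm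

end Load

/-! ### Trees given by a parent function -/

/-- Descending ranks connect every vertex to the root, and each edge is the parent edge of some
non-root vertex, so there are at most `|V| - 1` edges. -/
theorem isTree_of_parent {V : Type*} [Finite V] {T : SimpleGraph V} (r : V) (P : V → V)
    (rank : V → ℕ) (hrank : ∀ x, x ≠ r → rank (P x) < rank x)
    (hT : ∀ x y, T.Adj x y ↔ x ≠ y ∧ ((y ≠ r ∧ x = P y) ∨ (x ≠ r ∧ y = P x))) : T.IsTree := by
  classical
  have : Fintype V := Fintype.ofFinite V
  have hne : ∀ x, x ≠ r → P x ≠ x := fun x hx h => by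
    have := hrank x hx; rw [h] at this; exact lt_irrefl _ this
  have hconn : T.Connected := by
    have h0 : ∀ m x, rank x = m → T.Reachable r x := by
      intro m
      induction m using Nat.strong_induction_on with
      | _ m ih =>
        rintro x rfl
        by_cases hx : x = r
        · rw [hx]
        · exact (ih _ (hrank x hx) (P x) rfl).trans
            (Adj.reachable ((hT _ _).2 ⟨hne x hx, Or.inl ⟨hx, rfl⟩⟩))
    exact (connected_iff _).2 ⟨fun x y => (h0 _ x rfl).symm.trans (h0 _ y rfl), ⟨r⟩⟩
  rw [isTree_iff_connected_and_card]
  refine ⟨hconn, le_antisymm ?_ hconn.card_vert_le_card_edgeSet_add_one⟩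
  have hsub : T.edgeSet ⊆ (fun x => s(P x, x)) '' {x | x ≠ r} := by
    intro e he
    induction e with | _ x y =>
    obtain ⟨-, ⟨h1, h2⟩ | ⟨h1, h2⟩⟩ := (hT x y).1 he
    · exact ⟨y, h1, by simp [h2]⟩
    · exact ⟨x, h1, by simp [h2, Sym2.eq_swap]⟩
  have h1 : T.edgeSet.ncard ≤ {x | x ≠ r}.ncard :=
    (Set.ncard_le_ncard hsub (Set.toFinite _)).trans (Set.ncard_image_le (Set.toFinite _))
  have h2 : {x | x ≠ r}.ncard + 1 = Nat.card V := by
    have := Set.ncard_add_ncard_compl ({r} : Set V)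
    rw [Set.ncard_singleton] at this
    rw [← this, add_comm]; rfl
  rw [← h2]
  exact Nat.add_le_add_right h1 1

/-- A path of `G` inside an acyclic subgraph is determined by its ends. -/
theorem path_unique_of_edges {V : Type*} {G T : SimpleGraph V} (hT : T.IsAcyclic) {u v : V}
    (p q : G.Path u v) (hp : ∀ e ∈ p.1.edges, e ∈ T.edgeSet) (hq : ∀ e ∈ q.1.edges, e ∈ T.edgeSet) :
    p = q := by
  have h := (hT.subsingleton_path u v).elim ⟨p.1.transfer T hp, p.2.transfer hp⟩
    ⟨q.1.transfer T hq, q.2.transfer hq⟩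
  have h' : (p.1.transfer T hp).support = (q.1.transfer T hq).support :=
    congrArg (fun w : T.Path u v => w.1.support) h
  rw [Walk.support_transfer, Walk.support_transfer] at h'
  exact Subtype.ext (Walk.ext_support h')

/-! ### Semiregularity of the rotation -/

section Rotation

variable {n : ℕ} {a : ZMod n} (ha : a ^ 2 - a + 1 = 0) (h6 : n.Coprime 6)
include ha h6

/-- For `0 < m < 6` the element `ρ ^ m - 1` divides 6 in `ℤ[ρ]`; the coefficients of `h` are the
cofactors, and 6 is invertible modulo `n`. -/
theorem eq_zero_of_mul_root_pow_eq {x : ZMod n} {m : ℕ} (h0 : 0 < m) (hm : m < 6)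
    (h : x * a ^ m = x) : x = 0 := by
  have hu : IsUnit (6 : ZMod n) := by
    have := (ZMod.isUnit_iff_coprime 6 n).2 h6.symm
    exact_mod_cast this
  rw [← hu.mul_left_eq_zero]
  interval_cases m
  · linear_combination (-6 * a) * h + (6 * x) * ha
  · linear_combination (-2 * (a + 1)) * h + (2 * x * (a + 2)) * ha
  · linear_combination (-3) * h + (3 * x * (a + 1)) * ha
  · linear_combination (2 * (a - 2)) * h - (2 * x * (a ^ 3 - a ^ 2 - 2 * a - 1)) * ha
  · linear_combination (-6 * (1 - a)) * h - (6 * x * (a ^ 4 - a ^ 2 - a)) * ha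

theorem root_pow_injOn {x : ZMod n} (hx : x ≠ 0) {k l : ℕ} (hk : k < 6) (hl : l < 6)
    (h : x * a ^ k = x * a ^ l) : k = l := by
  have key : ∀ k l, k < l → l < 6 → x * a ^ k ≠ x * a ^ l := by
    intro k l hkl hl h
    have e : a ^ l = a ^ (l - k) * a ^ k := by rw [← pow_add, Nat.sub_add_cancel hkl.le]
    rw [e, ← mul_assoc] at h
    exact hx (eq_zero_of_mul_root_pow_eq ha h6 (by omega) (by omega)
      ((isUnit_root_pow ha k).mul_right_cancel h).symm)
  rcases lt_trichotomy k l with h1 | h1 | h1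
  · exact absurd h (key k l h1 hl)
  · exact h1
  · exact absurd h.symm (key l k h1 hk)

theorem root_pow_eq_of_mul_eq {x : ZMod n} (hx : x ≠ 0) {k l : ℕ}
    (h : x * a ^ k = x * a ^ l) : a ^ k = a ^ l := by
  rw [root_pow_mod ha k, root_pow_mod ha l] at h ⊢
  rw [root_pow_injOn ha h6 hx (Nat.mod_lt _ (by norm_num)) (Nat.mod_lt _ (by norm_num)) h]

theorem card_dart [NeZero n] (hn : 1 < n) [Fintype (frobGraph a).Dart] :
    Fintype.card (frobGraph a).Dart = n * 6 := by
  have : Fact (1 < n) := ⟨hn⟩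
  let F : ZMod n × Fin 6 → (frobGraph a).Dart := fun q =>
    ⟨(q.1, q.1 + a ^ (q.2 : ℕ)), (frobGraph_adj ha hn).2 ⟨_, rfl⟩⟩
  have hF : Function.Bijective F := by
    constructor
    · rintro ⟨x, k⟩ ⟨y, l⟩ h
      simp only [F, Dart.mk.injEq, Prod.mk.injEq] at h
      obtain ⟨rfl, h⟩ := h
      rw [add_right_inj] at h
      have := root_pow_injOn ha h6 (one_ne_zero (α := ZMod n)) k.2 l.2 (by rw [h])
      rw [Fin.ext this]
    · rintro ⟨⟨x, y⟩, h⟩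
      obtain ⟨k, rfl⟩ : ∃ k, y = x + a ^ k := (frobGraph_adj ha hn).1 h
      refine ⟨(x, ⟨k % 6, Nat.mod_lt _ (by norm_num)⟩), ?_⟩
      simp only [F, ← root_pow_mod ha]
  rw [← Fintype.card_of_bijective hF, Fintype.card_prod, ZMod.card, Fintype.card_fin]

end Rotation

/-! ### The parent map -/

/-- A rotation-invariant choice of a predecessor on a shortest path from the root. -/
structure IsParentMap {n : ℕ} (a : ZMod n) (P : ZMod n → ZMod n) : Prop where
  adj : ∀ x, x ≠ 0 → (frobGraph a).Adj (P x) x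
  dist : ∀ x, x ≠ 0 → (frobGraph a).dist 0 (P x) + 1 = (frobGraph a).dist 0 x
  rotate : ∀ x, x ≠ 0 → ∀ k, P (x * a ^ k) = P x * a ^ k

/-- Representatives of the orbits of the nonzero elements. -/
structure IsTransversal {n : ℕ} (a : ZMod n) (Y : Set (ZMod n)) : Prop where
  zero_notMem : 0 ∉ Y
  exists_mem : ∀ x, x ≠ 0 → ∃ v ∈ Y, ∃ k < 6, x = v * a ^ k
  unique : ∀ v ∈ Y, ∀ w ∈ Y, ∀ k, w = v * a ^ k → w = v

section ParentMap

variable {n : ℕ} {a : ZMod n} (ha : a ^ 2 - a + 1 = 0)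
include ha

theorem mul_root_pow_ne_zero {x : ZMod n} (hx : x ≠ 0) (k : ℕ) : x * a ^ k ≠ 0 := fun h =>
  hx ((isUnit_root_pow ha k).mul_left_eq_zero.1 h)

theorem isTransversal_sectorY [NeZero n] (hn : 1 < n) (hD : (frobGraph a).diam ^ 2 < n) :
    IsTransversal a (sectorY a) where
  zero_notMem := zero_notMem_sectorY ha hn hD
  exists_mem _ hx := exists_mem_sectorY ha hn hx
  unique _ hv _ hw _ h := eq_of_mem_sectorY ha hn hv hw h

theorem frobGraph_adj_mul_root_pow (hn : 1 < n) {x y : ZMod n} (k : ℕ) :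
    (frobGraph a).Adj (x * a ^ k) (y * a ^ k) ↔ (frobGraph a).Adj x y := by
  have key : ∀ x y k, (frobGraph a).Adj x y → (frobGraph a).Adj (x * a ^ k) (y * a ^ k) := by
    intro x y k h
    obtain ⟨l, rfl⟩ := (frobGraph_adj ha hn).1 h
    exact (frobGraph_adj ha hn).2 ⟨l + k, by rw [pow_add]; ring⟩
  refine ⟨fun h => ?_, key x y k⟩
  obtain ⟨l, hl⟩ := exists_root_pow_inv ha k
  have := key _ _ l h
  rwa [mul_assoc, mul_assoc, hl, mul_one, mul_one] at this

/-- The choice on `Y` extends by rotation. It is consistent because the rotation taking a nonzero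
`v` to a given element is unique. -/
theorem exists_isParentMap (hn : 1 < n) (h6 : n.Coprime 6) (hY : IsTransversal a (sectorY a))
    {p : ZMod n → ZMod n} (hp : IsParentChoice a p) :
    ∃ P, IsParentMap a P ∧ ∀ v ∈ sectorY a, P v = p v := by
  have h := hY.exists_mem
  choose! r hr k hk hx using h
  have hv0 : ∀ v ∈ sectorY a, v ≠ 0 := fun v hv h => hY.zero_notMem (h ▸ hv)
  have hrot : ∀ v ∈ sectorY a, ∀ l, p (r (v * a ^ l)) * a ^ k (v * a ^ l) = p v * a ^ l := by
    intro v hv l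
    have h0 := mul_root_pow_ne_zero ha (hv0 v hv) l
    have h1 := hx _ h0
    obtain ⟨m, hm⟩ := exists_root_pow_inv ha (k (v * a ^ l))
    have h2 : r (v * a ^ l) = v := by
      refine hY.unique v hv _ (hr _ h0) (l + m) ?_
      rw [pow_add, ← mul_assoc]
      conv_rhs => rw [h1]
      rw [mul_assoc, hm, mul_one]
    rw [h2] at h1 ⊢
    exact congrArg (p v * ·) (root_pow_eq_of_mul_eq ha h6 (hv0 v hv) h1).symm
  refine ⟨fun x => p (r x) * a ^ k x, ⟨fun x h0 => ?_, fun x h0 => ?_, fun x h0 l => ?_⟩,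
    fun v hv => ?_⟩
  · conv_rhs => rw [hx x h0]
    exact (frobGraph_adj_mul_root_pow ha hn _).2 (hp _ (hr x h0)).2.1
  · rw [frobGraph_dist_mul_root_pow ha, (hp _ (hr x h0)).2.2]
    conv_rhs => rw [hx x h0, frobGraph_dist_mul_root_pow ha]
  · have := hrot _ (hr x h0) (k x + l)
    rw [pow_add, ← mul_assoc, ← hx x h0] at this
    rw [this, mul_assoc]
  · have := hrot v hv 0
    simpa using this

omit ha in
theorem mem_rotatedArcs {P p : ZMod n → ZMod n} (hP : IsParentMap a P) {v : ZMod n} (hv : v ≠ 0)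
    (hpv : P v = p v) {x y : ZMod n} :
    (x, y) ∈ rotatedArcs a p v ↔ x = P y ∧ ∃ k ≤ 5, y = v * a ^ k := by
  simp only [rotatedArcs, Set.mem_ofPred_eq, Prod.mk.injEq]
  constructor
  · rintro ⟨k, hk, rfl, rfl⟩
    exact ⟨by rw [hP.rotate v hv, hpv], k, hk, rfl⟩
  · rintro ⟨rfl, k, hk, rfl⟩
    exact ⟨k, hk, by rw [hP.rotate v hv, hpv], rfl⟩

theorem treeT_adj (hY : IsTransversal a (sectorY a)) {P p : ZMod n → ZMod n}
    (hP : IsParentMap a P) (hp : ∀ v ∈ sectorY a, P v = p v) (u x y : ZMod n) :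
    (treeT a p u).Adj x y ↔
      x ≠ y ∧ ((y ≠ u ∧ x = P (y - u) + u) ∨ (x ≠ u ∧ y = P (x - u) + u)) := by
  have key : ∀ x y, (∃ v ∈ sectorY a, (x - u, y - u) ∈ rotatedArcs a p v) ↔
      (y ≠ u ∧ x = P (y - u) + u) := by
    intro x y
    constructor
    · rintro ⟨v, hv, h⟩
      have hv0 : v ≠ 0 := fun h => hY.zero_notMem (h ▸ hv)
      obtain ⟨h1, k, -, h2⟩ := (mem_rotatedArcs hP hv0 (hp v hv)).1 h
      refine ⟨fun h => ?_, by rw [← h1]; ring⟩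
      rw [h, sub_self] at h2
      exact mul_root_pow_ne_zero ha hv0 k h2.symm
    · rintro ⟨h1, h2⟩
      obtain ⟨v, hv, k, hk, e⟩ := hY.exists_mem (y - u) (sub_ne_zero.2 h1)
      have hv0 : v ≠ 0 := fun h => hY.zero_notMem (h ▸ hv)
      exact ⟨v, hv, (mem_rotatedArcs hP hv0 (hp v hv)).2 ⟨by rw [h2]; ring, k, by omega, e⟩⟩
  rw [treeT, fromRel_adj, key, key]

end ParentMap

/-! ### The trees and the routing -/

section Tree

variable {n : ℕ} {a : ZMod n} (ha : a ^ 2 - a + 1 = 0) {P : ZMod n → ZMod n}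
  (hP : IsParentMap a P)
include ha hP

theorem IsParentMap.adj_add {x u : ZMod n} (h : x ≠ u) :
    (frobGraph a).Adj (P (x - u) + u) x := by
  have := hP.adj (x - u) (sub_ne_zero.2 h)
  rw [frobGraph_eq_hexCayley ha] at this ⊢
  rw [← hexCayley_adj_add _ u] at this
  simpa using this

/-- The path from `w` to `v` in the tree rooted at `w`. -/
theorem IsParentMap.exists_walk (w v : ZMod n) :
    ∃ q : (frobGraph a).Walk w v, q.length = (frobGraph a).dist w v ∧
      (∀ i ≤ q.length, (frobGraph a).dist 0 (q.getVert i - w) = i) ∧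
      (∀ i < q.length, q.getVert (i + 1) ≠ w ∧
        q.getVert i = P (q.getVert (i + 1) - w) + w) ∧
      ∀ e ∈ q.edges, ∃ x, x ≠ w ∧ e = s(P (x - w) + w, x) := by
  generalize hm : (frobGraph a).dist w v = m
  induction m generalizing v with
  | zero =>
    have : w = v := ((frobGraph_connected ha).dist_eq_zero_iff).1 hm
    subst this
    exact ⟨Walk.nil, by simp, by simp, by simp, by simp⟩
  | succ m ih =>
    have hvw : v ≠ w := by rintro rfl; simp at hm
    have hd := hP.dist (v - w) (sub_ne_zero.2 hvw)
    rw [← frobGraph_dist_eq ha w v, hm] at hd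
    obtain ⟨q, h1, h2, h3, h4⟩ := ih (P (v - w) + w) (by
      rw [frobGraph_dist_eq ha, add_sub_cancel_right]; omega)
    have hc : ∀ i, (q.concat (hP.adj_add ha hvw)).getVert i =
        if i < q.length then q.getVert i else if i = q.length then P (v - w) + w else v := by
      intro i
      rw [Walk.concat_eq_append, Walk.getVert_append]
      split_ifs with h5 h6
      · rfl
      · subst h6; simp
      · obtain ⟨j, hj⟩ : ∃ j, i - q.length = j + 1 := ⟨i - q.length - 1, by omega⟩
        rw [hj]; simp
    refine ⟨q.concat (hP.adj_add ha hvw), by simp [h1], ?_, ?_, ?_⟩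
    · intro i hi
      rw [Walk.length_concat] at hi
      rw [hc]
      split_ifs with h5 h6
      · exact h2 i h5.le
      · rw [add_sub_cancel_right]; omega
      · rw [← frobGraph_dist_eq ha, hm]; omega
    · intro i hi
      rw [Walk.length_concat] at hi
      rw [hc, hc]
      by_cases h5 : i + 1 < q.length
      · rw [if_pos h5, if_pos (by omega)]; exact h3 i (by omega)
      · rw [if_neg h5]
        by_cases h6 : i + 1 = q.length
        · rw [if_pos h6, if_pos (by omega)]
          have := h3 i (by omega)
          rwa [h6, Walk.getVert_length] at this
        · rw [if_neg h6, if_neg (by omega), if_pos (by omega)]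
          exact ⟨hvw, rfl⟩
    · intro e he
      rw [Walk.edges_concat, List.concat_eq_append, List.mem_append, List.mem_singleton] at he
      rcases he with he | he
      · exact h4 e he
      · exact ⟨v, hvw, he⟩

variable {p : ZMod n → ZMod n} (hY : IsTransversal a (sectorY a)) (hp : ∀ v ∈ sectorY a, P v = p v)
include hY hp

theorem treeT_le (u : ZMod n) : treeT a p u ≤ frobGraph a := by
  intro x y h
  obtain ⟨-, ⟨h1, h2⟩ | ⟨h1, h2⟩⟩ := (treeT_adj ha hY hP hp u x y).1 h
  · rw [h2]; exact hP.adj_add ha h1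
  · rw [h2]; exact (hP.adj_add ha h1).symm

theorem treeT_isTree [NeZero n] (u : ZMod n) : (treeT a p u).IsTree := by
  refine isTree_of_parent u (fun x => P (x - u) + u) (fun x => (frobGraph a).dist 0 (x - u)) ?_
    (treeT_adj ha hY hP hp u)
  intro x hx
  have := hP.dist (x - u) (sub_ne_zero.2 hx)
  simp only [add_sub_cancel_right]; omega

/-- The path from `w` to `v` in the tree rooted at `w` as a path of the graph. -/
theorem exists_treePath (w v : ZMod n) :
    ∃ q : (frobGraph a).Path w v, q.1.length = (frobGraph a).dist w v ∧
      ∀ e ∈ q.1.edges, e ∈ (treeT a p w).edgeSet := by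
  obtain ⟨q, h1, -, -, h2⟩ := hP.exists_walk ha w v
  refine ⟨⟨q, q.isPath_of_length_eq_dist h1⟩, h1, fun e he => ?_⟩
  obtain ⟨x, hx, rfl⟩ := h2 e he
  rw [mem_edgeSet, treeT_adj ha hY hP hp]
  exact ⟨(hP.adj_add ha hx).ne, Or.inl ⟨hx, rfl⟩⟩

theorem existsUnique_treeRouting [NeZero n] :
    ∃! R : Routing (frobGraph a), IsTreeRouting a p R := by
  choose R hR using exists_treePath ha hP hY hp
  refine ⟨R, fun u v => (hR u v).2, fun R' hR' => ?_⟩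
  funext u v
  exact path_unique_of_edges (treeT_isTree ha hP hY hp u).isAcyclic _ _ (hR' u v) (hR u v).2

theorem IsTreeRouting.isShortestPathRouting [NeZero n] {R : Routing (frobGraph a)}
    (hR : IsTreeRouting a p R) : IsShortestPathRouting R := by
  intro u v
  obtain ⟨q, h1, h2⟩ := exists_treePath ha hP hY hp u v
  rw [path_unique_of_edges (treeT_isTree ha hP hY hp u).isAcyclic _ q (hR u v) h2, h1]

omit hP hY hp in
theorem mem_affineGroup [NeZero n] {g : Equiv.Perm (ZMod n)} :
    g ∈ affineGroup a ha ↔ ∃ y, ∃ k : ℕ, ∀ x, g x = (x + y) * a ^ k := by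
  have hpow : ∀ k : ℕ, ((solUnit a ha ^ k : (ZMod n)ˣ) : ZMod n) = a ^ k := fun k => by
    rw [Units.val_pow_eq_pow_val]; rfl
  change (∃ y : ZMod n, ∃ h ∈ complementH a ha, ∀ x, g x = (x + y) * (h : ZMod n)) ↔ _
  refine exists_congr fun y => ⟨?_, ?_⟩
  · rintro ⟨h, hh, hg⟩
    rw [complementH, ← mem_powers_iff_mem_zpowers] at hh
    obtain ⟨k, rfl⟩ := hh
    exact ⟨k, fun x => by rw [hg]; simp only [hpow]⟩
  · rintro ⟨k, hg⟩
    exact ⟨solUnit a ha ^ k, Subgroup.npow_mem_zpowers _ _, fun x => by rw [hg, hpow]⟩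

/-- By rotation invariance of the parent map, `g` carries the tree at `u` to the tree at `g u`;
uniqueness of tree paths then carries the routing to itself. -/
theorem IsTreeRouting.isArcTransitiveRouting [NeZero n] (hn : 1 < n) {R : Routing (frobGraph a)}
    (hR : IsTreeRouting a p R) : IsArcTransitiveRouting (affineGroup a ha) R := by
  have hauto : ∀ g ∈ affineGroup a ha, ∀ x y, (frobGraph a).Adj (g x) (g y) ↔ (frobGraph a).Adj x y := by
    intro g hg x y
    obtain ⟨z, k, hg⟩ := (mem_affineGroup ha).1 hg
    rw [hg, hg, frobGraph_adj_mul_root_pow ha hn, frobGraph_eq_hexCayley ha, hexCayley_adj_add]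
  refine ⟨hauto, ?_, ?_⟩
  · intro g hg u v
    let φ : frobGraph a →g frobGraph a := ⟨g, fun {x y} h => (hauto g hg x y).2 h⟩
    have hpath : ((R u v).1.map φ).IsPath := (R u v).2.map g.injective
    have hedge : ∀ e ∈ ((R u v).1.map φ).edges, e ∈ (treeT a p (g u)).edgeSet := by
      intro e he
      rw [Walk.edges_map, List.mem_map] at he
      obtain ⟨e, he, rfl⟩ := he
      have he' := hR u v e he
      clear he
      induction e with | _ x y =>
      rw [mem_edgeSet, treeT_adj ha hY hP hp] at he'
      rw [Sym2.map_mk, mem_edgeSet]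
      change (treeT a p (g u)).Adj (g x) (g y)
      rw [treeT_adj ha hY hP hp]
      obtain ⟨z, k, hgx⟩ := (mem_affineGroup ha).1 hg
      have key : ∀ x y, y ≠ u ∧ x = P (y - u) + u → g y ≠ g u ∧ g x = P (g y - g u) + g u := by
        rintro x y ⟨h1, h2⟩
        refine ⟨g.injective.ne h1, ?_⟩
        have e1 : g y - g u = (y - u) * a ^ k := by rw [hgx, hgx]; ring
        rw [e1, hP.rotate _ (sub_ne_zero.2 h1), hgx x, h2, hgx]; ring
      exact ⟨g.injective.ne he'.1, he'.2.imp (key x y) (key y x)⟩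
    have h := path_unique_of_edges (treeT_isTree ha hP hY hp (g u)).isAcyclic
      ⟨(R u v).1.map φ, hpath⟩ (R (g u) (g v)) hedge (hR _ _)
    rw [← h, Walk.support_map]; rfl
  · intro x y x' y' h h'
    obtain ⟨k, rfl⟩ := (frobGraph_adj ha hn).1 h
    obtain ⟨l, rfl⟩ := (frobGraph_adj ha hn).1 h'
    obtain ⟨m, hm⟩ := exists_root_pow_inv ha k
    obtain ⟨m', hm'⟩ := exists_root_pow_inv ha (m + l)
    have hu : a ^ (m + l) * a ^ m' = 1 := hm'
    -- Here `a ^ m` inverts `a ^ k` and `a ^ m'` inverts `a ^ (m + l)`: multiplication by `a ^ (m +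
    -- l)` turns direction `a ^ k` into `a ^ l`, and the shift `y0` sends `x` to `x'`.
    let y0 := x' * a ^ m' - x
    let g : Equiv.Perm (ZMod n) :=
      { toFun := fun z => (z + y0) * a ^ (m + l)
        invFun := fun z => z * a ^ m' - y0
        left_inv := fun z => by linear_combination (z + y0) * hu
        right_inv := fun z => by linear_combination z * hu }
    refine ⟨g, (mem_affineGroup ha).2 ⟨y0, m + l, fun z => rfl⟩, ?_, ?_⟩
    · change (x + (x' * a ^ m' - x)) * a ^ (m + l) = x'
      linear_combination x' * hu
    · change (x + a ^ k + (x' * a ^ m' - x)) * a ^ (m + l) = x' + a ^ l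
      rw [pow_add] at hu ⊢
      linear_combination x' * hu + a ^ l * hm

end Tree

/-! ### The schedule of the gossiping algorithm -/

/-- The time step in which a message reaches the vertex at displacement `x` from its origin. -/
structure IsSchedule {n : ℕ} (a : ZMod n) (N : ℕ) (τ : ZMod n → ℕ) : Prop where
  rotate : ∀ x, x ≠ 0 → ∀ k, τ (x * a ^ k) = τ x
  inj : ∀ x, x ≠ 0 → ∀ y, y ≠ 0 → τ x = τ y → ∃ k, y = x * a ^ k
  mono : ∀ x, x ≠ 0 → ∀ y, y ≠ 0 → (frobGraph a).dist 0 x < (frobGraph a).dist 0 y → τ x < τ y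
  pos : ∀ x, x ≠ 0 → 1 ≤ τ x
  le : ∀ x, x ≠ 0 → τ x ≤ N
  surj : ∀ s, 1 ≤ s → s ≤ N → ∃ x, x ≠ 0 ∧ τ x = s

section Schedule

variable {n : ℕ} [NeZero n] {a : ZMod n} (ha : a ^ 2 - a + 1 = 0)
include ha

theorem ncard_sectorY (h6 : n.Coprime 6) (hY : IsTransversal a (sectorY a)) :
    6 * (sectorY a).ncard + 1 = n := by
  have h1 : {x : ZMod n | x ≠ 0}.ncard + 1 = n := by
    have := Set.ncard_add_ncard_compl ({0} : Set (ZMod n))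
    rw [Set.ncard_singleton, Nat.card_zmod] at this
    rw [add_comm] at this
    rwa [show {x : ZMod n | x ≠ 0} = {0}ᶜ by ext; simp]
  have h2 : {x : ZMod n | x ≠ 0} = (fun q : ZMod n × ℕ => q.1 * a ^ q.2) ''
      (sectorY a ×ˢ (Finset.range 6 : Set ℕ)) := by
    ext x
    simp only [Set.mem_ofPred_eq, Set.mem_image, Set.mem_prod, Finset.mem_coe, Finset.mem_range,
      Prod.exists]
    constructor
    · intro hx
      obtain ⟨v, hv, k, hk, e⟩ := hY.exists_mem x hx
      exact ⟨v, k, ⟨hv, hk⟩, e.symm⟩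
    · rintro ⟨v, k, ⟨hv, -⟩, rfl⟩
      exact mul_root_pow_ne_zero ha (fun h => hY.zero_notMem (h ▸ hv)) k
  refine Eq.trans ?_ h1
  rw [h2, Set.InjOn.ncard_image, Set.ncard_prod, Set.ncard_coe_finset, Finset.card_range,
    mul_comm]
  rintro ⟨v, k⟩ ⟨hv, hk⟩ ⟨w, l⟩ ⟨hw, hl⟩ h
  simp only [Finset.mem_coe, Finset.mem_range] at hk hl hv hw h
  obtain ⟨m, hm⟩ := exists_root_pow_inv ha l
  have e : w = v := by
    refine hY.unique v hv w hw (k + m) ?_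
    rw [pow_add, ← mul_assoc, h, mul_assoc, hm, mul_one]
  subst e
  rw [root_pow_injOn ha h6 (fun h => hY.zero_notMem (h ▸ hw)) hk hl h]

theorem sum_layerCard (hY : IsTransversal a (sectorY a)) :
    ∑ t ∈ Finset.Ico 1 ((frobGraph a).diam + 1), layerCard a t = (sectorY a).ncard := by
  classical
  have hfin : (sectorY a).Finite := Set.toFinite _
  rw [Set.ncard_eq_toFinset_card _ hfin,
    Finset.card_eq_sum_card_fiberwise (f := fun v => (frobGraph a).dist 0 v)
      (t := Finset.Ico 1 ((frobGraph a).diam + 1))]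
  · refine Finset.sum_congr rfl fun t _ => ?_
    rw [layerCard, ← Set.ncard_coe_finset]
    congr 1
    ext v
    simp [layer]
  · intro v hv
    have hv' : v ∈ sectorY a := by simpa using hv
    have h0 : (0 : ZMod n) ≠ v := fun h => hY.zero_notMem (h ▸ hv')
    simp only [Finset.coe_Ico, Set.mem_Ico]
    exact ⟨(frobGraph_connected ha).pos_dist_of_ne h0,
      Nat.lt_succ_of_le (frobGraph_dist_le_diam ha 0 v)⟩

/-- The time of a representative is the total size of the earlier layers plus its one-based position
in its own layer; other elements inherit it by rotation. -/
theorem exists_schedule (hY : IsTransversal a (sectorY a))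
    (ord : ∀ t, Fin (layerCard a t) ≃ layer a t) :
    ∃ τ, IsSchedule a (sectorY a).ncard τ ∧
      ∀ (t : ℕ) (l : Fin (layerCard a t)),
        τ (ord t l) = ∑ i ∈ Finset.Ico 1 t, layerCard a i + (l + 1) := by
  have h : ∀ v ∈ sectorY a, ∃ m, ∃ h : m < layerCard a ((frobGraph a).dist 0 v),
      (ord ((frobGraph a).dist 0 v) ⟨m, h⟩ : ZMod n) = v := by
    intro v hv
    obtain ⟨l, hl⟩ := (ord ((frobGraph a).dist 0 v)).surjective ⟨v, hv, rfl⟩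
    exact ⟨l, l.2, by rw [Fin.eta, hl]⟩
  choose! m hm hord using h
  have hordm : ∀ t (l : Fin (layerCard a t)) v, (ord t l : ZMod n) = v →
      t = (frobGraph a).dist 0 v ∧ (l : ℕ) = m v := by
    intro t l v hv
    have hvY : v ∈ sectorY a := hv ▸ (ord t l).2.1
    have ht : (frobGraph a).dist 0 v = t := hv ▸ (ord t l).2.2
    subst ht
    refine ⟨rfl, ?_⟩
    have := (ord ((frobGraph a).dist 0 v)).injective
      (Subtype.ext (hv.trans (hord v hvY).symm))
    rw [this]
  have hcongr : ∀ t t' k k' (h : k < layerCard a t) (h' : k' < layerCard a t'), t = t' → k = k' →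
      (ord t ⟨k, h⟩ : ZMod n) = ord t' ⟨k', h'⟩ := by
    rintro t t' k k' h h' rfl rfl; rfl
  set σ : ZMod n → ℕ := fun v =>
    ∑ i ∈ Finset.Ico 1 ((frobGraph a).dist 0 v), layerCard a i + (m v + 1) with hσ
  have hne : ∀ v ∈ sectorY a, v ≠ 0 := fun v hv h => hY.zero_notMem (h ▸ hv)
  have hpos : ∀ v ∈ sectorY a, 1 ≤ (frobGraph a).dist 0 v := fun v hv =>
    (frobGraph_connected ha).pos_dist_of_ne (hne v hv).symm
  have hσle : ∀ v ∈ sectorY a, ∀ t, (frobGraph a).dist 0 v < t →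
      σ v ≤ ∑ i ∈ Finset.Ico 1 t, layerCard a i := by
    intro v hv t ht
    calc σ v ≤ ∑ i ∈ Finset.Ico 1 ((frobGraph a).dist 0 v + 1), layerCard a i := by
          rw [Finset.sum_Ico_succ_top (hpos v hv)]
          exact Nat.add_le_add_left (hm v hv) _
      _ ≤ _ := Finset.sum_le_sum_of_subset (Finset.Ico_subset_Ico le_rfl ht)
  have hσmono : ∀ v ∈ sectorY a, ∀ w, (frobGraph a).dist 0 v < (frobGraph a).dist 0 w →
      σ v < σ w := by
    intro v hv w hvw
    have := hσle v hv _ hvw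
    simp only [hσ] at this ⊢
    omega
  have hσinj : ∀ v ∈ sectorY a, ∀ w ∈ sectorY a, σ v = σ w → v = w := by
    intro v hv w hw h
    have hd : (frobGraph a).dist 0 v = (frobGraph a).dist 0 w := by
      rcases lt_trichotomy ((frobGraph a).dist 0 v) ((frobGraph a).dist 0 w) with h1 | h1 | h1
      · exact absurd h (hσmono v hv w h1).ne
      · exact h1
      · exact absurd h.symm (hσmono w hw v h1).ne
    have hmm : m v = m w := by simp only [hσ, hd] at h; omega
    rw [← hord v hv, ← hord w hw]
    exact hcongr _ _ _ _ _ _ hd hmm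
  have hσN : ∀ v ∈ sectorY a, σ v ≤ (sectorY a).ncard := by
    intro v hv
    rw [← sum_layerCard ha hY]
    exact hσle v hv _ (Nat.lt_succ_of_le (frobGraph_dist_le_diam ha 0 v))
  -- An injection of `Y` into an interval of the same size leaves no time step idle.
  have hσsurj : σ '' sectorY a = (Finset.Icc 1 (sectorY a).ncard : Set ℕ) := by
    refine Set.eq_of_subset_of_ncard_le ?_ ?_ (Finset.finite_toSet _)
    · rintro _ ⟨v, hv, rfl⟩
      simp only [Finset.coe_Icc, Set.mem_Icc]
      exact ⟨by simp only [hσ]; omega, hσN v hv⟩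
    · rw [Set.ncard_coe_finset, Nat.card_Icc, Set.InjOn.ncard_image]
      · omega
      · exact fun v hv w hw h => hσinj v hv w hw h
  have hr := hY.exists_mem
  choose! r hrY k _ hrk using hr
  have hrr : ∀ v ∈ sectorY a, ∀ l, r (v * a ^ l) = v := by
    intro v hv l
    have h0 := mul_root_pow_ne_zero ha (hne v hv) l
    obtain ⟨j, hj⟩ := exists_root_pow_inv ha (k (v * a ^ l))
    refine hY.unique v hv _ (hrY _ h0) (l + j) ?_
    rw [pow_add, ← mul_assoc]
    conv_rhs => rw [hrk _ h0]
    rw [mul_assoc, hj, mul_one]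
  have hrv : ∀ v ∈ sectorY a, r v = v := fun v hv => by simpa using hrr v hv 0
  have hdist : ∀ x, x ≠ 0 → (frobGraph a).dist 0 (r x) = (frobGraph a).dist 0 x := fun x hx => by
    conv_rhs => rw [hrk x hx, frobGraph_dist_mul_root_pow ha]
  refine ⟨fun x => σ (r x), ⟨?_, ?_, ?_, ?_, ?_, ?_⟩, ?_⟩
  · intro x hx l
    have := hrr _ (hrY x hx) (k x + l)
    rw [pow_add, ← mul_assoc, ← hrk x hx] at this
    simp only [this]
  · intro x hx y hy h
    have e := hσinj _ (hrY x hx) _ (hrY y hy) h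
    obtain ⟨j, hj⟩ := exists_root_pow_inv ha (k x)
    refine ⟨j + k y, ?_⟩
    conv_rhs => rw [hrk x hx]
    rw [e, mul_assoc, pow_add, ← mul_assoc (a ^ k x), hj, one_mul]
    exact hrk y hy
  · intro x hx y hy h
    refine hσmono _ (hrY x hx) _ ?_
    rwa [hdist x hx, hdist y hy]
  · intro x _
    simp only [hσ]; omega
  · intro x hx
    exact hσN _ (hrY x hx)
  · intro s h1 h2
    have : s ∈ σ '' sectorY a := by rw [hσsurj]; simp [h1, h2]
    obtain ⟨v, hv, rfl⟩ := this
    exact ⟨v, hne v hv, by simp only [hrv v hv]⟩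
  · intro t l
    have hv : (ord t l : ZMod n) ∈ sectorY a := (ord t l).2.1
    obtain ⟨h1, h2⟩ := hordm t l _ rfl
    simp only [hrv _ hv, hσ]
    rw [← h1, ← h2]

/-- The sends of the gossiping algorithm in terms of a parent map and a schedule. -/
def scheduledSend {n : ℕ} (P : ZMod n → ZMod n) (τ : ZMod n → ℕ) :
    ℕ → ZMod n → ZMod n → ZMod n → Prop :=
  fun s w x y => y ≠ w ∧ x - w = P (y - w) ∧ s = τ (y - w)

theorem algorithmSend_eq (hY : IsTransversal a (sectorY a))
    {P p : ZMod n → ZMod n} (hP : IsParentMap a P) (hp : ∀ v ∈ sectorY a, P v = p v)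
    (ord : ∀ t, Fin (layerCard a t) ≃ layer a t) {N : ℕ} {τ : ZMod n → ℕ} (hτ : IsSchedule a N τ)
    (hord : ∀ (t : ℕ) (l : Fin (layerCard a t)),
        τ (ord t l) = ∑ i ∈ Finset.Ico 1 t, layerCard a i + (l + 1)) :
    algorithmSend a p ord = scheduledSend P τ := by
  have hne : ∀ v ∈ sectorY a, v ≠ 0 := fun v hv h => hY.zero_notMem (h ▸ hv)
  funext s w x y
  refine propext ⟨?_, ?_⟩
  · rintro ⟨t, -, -, l, hs, hmem⟩
    have hv : (ord t l : ZMod n) ∈ sectorY a := (ord t l).2.1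
    obtain ⟨h1, k, -, h2⟩ := (mem_rotatedArcs hP (hne _ hv) (hp _ hv)).1 hmem
    refine ⟨fun h => ?_, h1, ?_⟩
    · rw [h, sub_self] at h2
      exact mul_root_pow_ne_zero ha (hne _ hv) k h2.symm
    · rw [h2, hτ.rotate _ (hne _ hv), hord, hs]
  · rintro ⟨hyw, hx, hs⟩
    obtain ⟨v, hv, k, hk, e⟩ := hY.exists_mem (y - w) (sub_ne_zero.2 hyw)
    obtain ⟨l, hl⟩ := (ord ((frobGraph a).dist 0 v)).surjective ⟨v, hv, rfl⟩
    refine ⟨(frobGraph a).dist 0 v, (frobGraph_connected ha).pos_dist_of_ne (hne v hv).symm,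
      frobGraph_dist_le_diam ha 0 v, l, ?_, ?_⟩
    · rw [hs, e, hτ.rotate v (hne v hv), ← hord, hl]
    · rw [hl]
      exact (mem_rotatedArcs hP (hne v hv) (hp v hv)).2 ⟨hx, k, by omega, e⟩

end Schedule

/-! ### Gossiping -/

theorem exists_send_of_mem_knows {V : Type*} {send : ℕ → V → V → V → Prop} {T : ℕ} {w x : V}
    (h : w ∈ Knows send T x) (hwx : w ≠ x) : ∃ s y, send s w y x := by
  induction T with
  | zero => exact absurd h hwx
  | succ T ih =>
    rcases h with h | ⟨y, h⟩
    · exact ih h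
    · exact ⟨_, y, h⟩

theorem knows_mono {V : Type*} (send : ℕ → V → V → V → Prop) (x : V) :
    Monotone fun s => Knows send s x :=
  monotone_nat_of_le_succ fun _ => Set.subset_union_left

theorem mem_knows_of_send {V : Type*} {send : ℕ → V → V → V → Prop} {s t : ℕ} {w x y : V}
    (h : send s w y x) (h1 : 1 ≤ s) (hst : s ≤ t) : w ∈ Knows send t x := by
  obtain ⟨s, rfl⟩ : ∃ r, s = r + 1 := ⟨s - 1, by omega⟩
  exact knows_mono send x hst (Or.inr ⟨y, h⟩)

theorem self_mem_knows {V : Type*} (send : ℕ → V → V → V → Prop) (s : ℕ) (x : V) :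
    x ∈ Knows send s x := knows_mono send x (Nat.zero_le s) rfl

section Gossip

variable {n : ℕ} [NeZero n] {a : ZMod n} (ha : a ^ 2 - a + 1 = 0) (hn : 1 < n)
include ha hn

/-- Vertex `0` must receive `n - 1` foreign messages, and each pair of a time step and an incoming
direction delivers at most one. -/
theorem IsGossipScheme.le_mul_six {T : ℕ} {send : ℕ → ZMod n → ZMod n → ZMod n → Prop}
    (h : IsGossipScheme (frobGraph a) T send) : n ≤ 6 * T + 1 := by
  have hs : ∀ w : ZMod n, w ≠ 0 → ∃ s, ∃ k < 6, send s w (0 - a ^ k) 0 := by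
    intro w hw
    obtain ⟨s, y, hy⟩ := exists_send_of_mem_knows (h.complete w 0) hw
    obtain ⟨k, hk⟩ := (frobGraph_adj ha hn).1 (h.adj _ _ _ _ hy)
    refine ⟨s, k % 6, Nat.mod_lt _ (by norm_num), ?_⟩
    rw [← root_pow_mod ha, hk, add_sub_cancel_right]
    rwa [← hk]
  choose! s k hk hsend using hs
  have h1 : (Finset.univ.erase (0 : ZMod n)).card ≤
      (Finset.Icc 1 T ×ˢ Finset.range 6).card := by
    refine Finset.card_le_card_of_injOn (fun w => (s w, k w)) ?_ ?_
    · intro w hw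
      have hw0 : w ≠ 0 := Finset.ne_of_mem_erase hw
      have := h.time _ _ _ _ (hsend w hw0)
      simp [this, hk w hw0]
    · intro w hw w' hw' he
      have e := hsend w (Finset.ne_of_mem_erase hw)
      have e' := hsend w' (Finset.ne_of_mem_erase hw')
      simp only [Prod.mk.injEq] at he
      rw [he.1, he.2] at e
      exact h.one_message _ _ _ _ _ e e'
  rw [Finset.card_erase_of_mem (Finset.mem_univ _), Finset.card_univ, ZMod.card,
    Finset.card_product, Nat.card_Icc, Finset.card_range] at h1
  omega

variable {P : ZMod n → ZMod n} (hP : IsParentMap a P) {N : ℕ} {τ : ZMod n → ℕ}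
  (hτ : IsSchedule a N τ)
include hP

omit [NeZero n] in
theorem IsParentMap.exists_sub_eq {z : ZMod n} (hz : z ≠ 0) : ∃ k, z - P z = a ^ k := by
  obtain ⟨k, hk⟩ := (frobGraph_adj ha hn).1 (hP.adj z hz)
  exact ⟨k, by rw [sub_eq_iff_eq_add']; exact hk⟩

include hτ

omit [NeZero n] in
-- Equal times put the two displacements in one orbit, related by some `a ^ k`. Both tree arcs have
-- the same direction `y - x`, a unit, so `a ^ k = 1` and the origins agree.
theorem scheduledSend_one_message (s : ℕ) (w w' x y : ZMod n) (h : scheduledSend P τ s w x y)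
    (h' : scheduledSend P τ s w' x y) : w = w' := by
  obtain ⟨h1, h2, h3⟩ := h
  obtain ⟨h1', h2', h3'⟩ := h'
  have hz := sub_ne_zero.2 h1
  obtain ⟨k, hk⟩ := hτ.inj (y - w) hz (y - w') (sub_ne_zero.2 h1') (h3.symm.trans h3')
  have hr := hP.rotate _ hz k
  rw [← hk, ← h2', ← h2] at hr
  obtain ⟨l, hl⟩ := hP.exists_sub_eq ha hn hz
  rw [← h2, sub_sub_sub_cancel_right] at hl
  have e : a ^ l * a ^ k = a ^ l := by
    rw [← hl]; linear_combination hr - hk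
  have ek : a ^ k = 1 := by
    apply (isUnit_root_pow ha l).mul_left_cancel
    rw [e, mul_one]
  rw [ek, mul_one] at hk
  exact (sub_right_inj.1 hk).symm

omit [NeZero n] in
theorem scheduledSend_isGossipScheme :
    IsGossipScheme (frobGraph a) N (scheduledSend P τ) where
  time s w x y := by
    rintro ⟨h1, -, rfl⟩
    exact ⟨hτ.pos _ (sub_ne_zero.2 h1), hτ.le _ (sub_ne_zero.2 h1)⟩
  adj s w x y := by
    rintro ⟨h1, h2, -⟩
    rw [sub_eq_iff_eq_add.1 h2]
    exact hP.adj_add ha h1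
  one_message := scheduledSend_one_message ha hn hP hτ
  store_forward s w x y := by
    rintro ⟨h1, h2, h3⟩
    by_cases hx : x = w
    · rw [hx]; exact self_mem_knows _ _ _
    · have h4 := hP.dist _ (sub_ne_zero.2 h1)
      have h5 := hτ.mono (x - w) (sub_ne_zero.2 hx) (y - w) (sub_ne_zero.2 h1) (by rw [h2]; omega)
      exact mem_knows_of_send (y := P (x - w) + w) ⟨hx, by simp, rfl⟩
        (hτ.pos _ (sub_ne_zero.2 hx)) (by omega)
  complete w x := by
    by_cases hx : x = w
    · rw [hx]; exact self_mem_knows _ _ _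
    · exact mem_knows_of_send (y := P (x - w) + w) ⟨hx, by simp, rfl⟩
        (hτ.pos _ (sub_ne_zero.2 hx)) (hτ.le _ (sub_ne_zero.2 hx))

theorem gossipTime_eq (hN : 6 * N + 1 = n) : gossipTime (frobGraph a) = N := by
  have hmem : N ∈ {T | ∃ send, IsGossipScheme (frobGraph a) T send} :=
    ⟨_, scheduledSend_isGossipScheme ha hn hP hτ⟩
  refine le_antisymm (Nat.sInf_le hmem) (le_csInf ⟨_, hmem⟩ ?_)
  rintro T ⟨send, h⟩
  have := h.le_mul_six ha hn
  omega

omit hn [NeZero n] in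
theorem scheduledSend_reaches (w v : ZMod n) :
    ReachesAlongShortestPath (frobGraph a) (scheduledSend P τ) w v := by
  obtain ⟨q, h1, h2, h3, -⟩ := hP.exists_walk ha w v
  refine ⟨q, h1, fun i => τ (q.getVert (i + 1) - w), ?_, ?_⟩
  · intro i hi j hj hij
    rw [Set.mem_Iio] at hi hj
    refine hτ.mono _ (sub_ne_zero.2 (h3 i hi).1) _ (sub_ne_zero.2 (h3 j hj).1) ?_
    rw [h2 _ hi, h2 _ hj]
    omega
  · intro i hi
    obtain ⟨h4, h5⟩ := h3 i hi
    exact ⟨h4, by rw [sub_eq_iff_eq_add]; exact h5, rfl⟩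

omit hn hτ [NeZero n] in
theorem scheduledSend_dist (s : ℕ) (w x y : ZMod n) (h : scheduledSend P τ s w x y) :
    (frobGraph a).dist w y = (frobGraph a).dist w x + 1 := by
  obtain ⟨h1, h2, -⟩ := h
  rw [frobGraph_dist_eq ha w y, frobGraph_dist_eq ha w x, h2, hP.dist _ (sub_ne_zero.2 h1)]

omit hn [NeZero n] in
theorem arcsUsed_scheduledSend {z : ZMod n} (hz : z ≠ 0) (w : ZMod n) :
    arcsUsed (scheduledSend P τ) (τ z) w =
      (fun k : ℕ => (P z * a ^ k + w, z * a ^ k + w)) '' (Finset.range 6 : Set ℕ) := by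
  ext ⟨x, y⟩
  simp only [arcsUsed, scheduledSend, Set.mem_ofPred_eq, Set.mem_image, Finset.mem_coe,
    Finset.mem_range, Prod.mk.injEq]
  constructor
  · rintro ⟨h1, h2, h3⟩
    obtain ⟨k, hk⟩ := hτ.inj z hz _ (sub_ne_zero.2 h1) h3
    refine ⟨k % 6, Nat.mod_lt _ (by norm_num), ?_, ?_⟩
    · rw [← root_pow_mod ha, ← hP.rotate z hz, ← hk, ← h2]; ring
    · rw [← root_pow_mod ha, ← hk]; ring
  · rintro ⟨k, -, rfl, rfl⟩
    have := mul_root_pow_ne_zero ha hz k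
    refine ⟨by simpa using this, ?_, ?_⟩
    · rw [add_sub_cancel_right, add_sub_cancel_right, hP.rotate z hz]
    · rw [add_sub_cancel_right, hτ.rotate z hz]

omit hn [NeZero n] in
theorem ncard_arcsUsed_scheduledSend (h6 : n.Coprime 6) {s : ℕ} (h1 : 1 ≤ s) (h2 : s ≤ N)
    (w : ZMod n) : (arcsUsed (scheduledSend P τ) s w).ncard = 6 := by
  obtain ⟨z, hz, rfl⟩ := hτ.surj s h1 h2
  rw [arcsUsed_scheduledSend ha hP hτ hz, Set.InjOn.ncard_image, Set.ncard_coe_finset,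
    Finset.card_range]
  intro k hk l hl h
  simp only [Finset.mem_coe, Finset.mem_range] at hk hl
  simp only [Prod.mk.injEq, add_left_inj] at h
  exact root_pow_injOn ha h6 hz hk hl h.2

omit [NeZero n] in
-- The neighbours of the root form a single orbit, served in step 1. From step 2 on no tail is the
-- root, so the six rotated tails are distinct and a matching is possible.
theorem parent_ne_zero {z : ZMod n} (hz : z ≠ 0) (h2 : 2 ≤ τ z) : P z ≠ 0 := by
  intro h0
  have : Fact (1 < n) := ⟨hn⟩
  obtain ⟨k, hk⟩ := hP.exists_sub_eq ha hn hz
  rw [h0, sub_zero] at hk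
  have hτ1 : τ z = τ 1 := by
    rw [hk, ← one_mul (a ^ k)]; exact hτ.rotate 1 one_ne_zero k
  have hd : (frobGraph a).dist 0 z = 1 := by rw [← hP.dist z hz, h0]; simp
  obtain ⟨x, hx, hx1⟩ := hτ.surj 1 le_rfl ((by omega : 1 ≤ τ z).trans (hτ.le z hz))
  have hdx : 1 ≤ (frobGraph a).dist 0 x := (frobGraph_connected ha).pos_dist_of_ne hx.symm
  rcases hdx.eq_or_lt with h | h
  · obtain ⟨l, hl⟩ := (frobGraph_adj ha hn).1 (dist_eq_one_iff_adj.1 h.symm)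
    rw [zero_add] at hl
    have : τ x = τ 1 := by
      rw [hl, ← one_mul (a ^ l)]; exact hτ.rotate 1 one_ne_zero l
    omega
  · have := hτ.mono z hz x hx (by omega)
    omega

omit [NeZero n] in
theorem isArcMatching_arcsUsed (h6 : n.Coprime 6) {s : ℕ} (h1 : 2 ≤ s) (h2 : s ≤ N) (w : ZMod n) :
    IsArcMatching (arcsUsed (scheduledSend P τ) s w) := by
  obtain ⟨z, hz, rfl⟩ := hτ.surj s (by omega) h2
  have hPz := parent_ne_zero ha hn hP hτ hz h1
  have hd := hP.dist z hz
  rw [arcsUsed_scheduledSend ha hP hτ hz]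
  -- Tails and heads lie at consecutive distances from the origin, so no tail is a head.
  have hcross : ∀ k l : ℕ, P z * a ^ k ≠ z * a ^ l := by
    intro k l h
    have := congrArg ((frobGraph a).dist 0) h
    rw [frobGraph_dist_mul_root_pow ha, frobGraph_dist_mul_root_pow ha] at this
    omega
  rintro _ ⟨k, hk, rfl⟩ _ ⟨l, hl, rfl⟩ hne
  simp only [Finset.mem_coe, Finset.mem_range] at hk hl
  have hkl : k ≠ l := by rintro rfl; exact hne rfl
  simp only [ne_eq, add_left_inj]
  exact ⟨fun h => hkl (root_pow_injOn ha h6 hPz hk hl h), hcross k l,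
    fun h => hcross l k h.symm, fun h => hkl (root_pow_injOn ha h6 hz hk hl h)⟩

omit [NeZero n] in
-- One rotation of the tree arc served at this step has the direction of the given arc, and a
-- translation moves it there; the origin is read off from the translation.
theorem existsUnique_scheduledSend {s : ℕ} (h1 : 1 ≤ s) (h2 : s ≤ N) {x y : ZMod n}
    (h : (frobGraph a).Adj x y) : ∃! w, scheduledSend P τ s w x y := by
  obtain ⟨z, hz, rfl⟩ := hτ.surj s h1 h2
  obtain ⟨k, rfl⟩ := (frobGraph_adj ha hn).1 h
  obtain ⟨m, hm⟩ := hP.exists_sub_eq ha hn hz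
  obtain ⟨l, hl⟩ := exists_root_pow_inv ha m
  have hz' := mul_root_pow_ne_zero ha hz (l + k)
  refine ⟨x + a ^ k - z * a ^ (l + k), ⟨?_, ?_, ?_⟩, fun w' hw' =>
    scheduledSend_one_message ha hn hP hτ _ _ _ _ _ hw' ⟨?_, ?_, ?_⟩⟩
  all_goals first
    | (rw [sub_sub_cancel, hP.rotate z hz, pow_add]
       linear_combination (a ^ l * a ^ k) * hm + a ^ k * hl)
    | (rw [sub_sub_cancel, hτ.rotate z hz])
    | (intro h
       exact hz' (by linear_combination h))

end Gossip

/-! ### The diameter and the distance sum of the circulants -/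

section Transfer

variable {n : ℕ} [NeZero n] {a : ZMod n} (ha : a ^ 2 - a + 1 = 0)

theorem diam_eq_of_iso {V W : Type*} [Finite V] [Finite W] {G : SimpleGraph V}
    {G' : SimpleGraph W} (φ : G ≃g G') (hG : G.Connected) (hG' : G'.Connected) :
    G.diam = G'.diam := by
  have := hG.nonempty
  have := hG'.nonempty
  apply le_antisymm
  · obtain ⟨u, v, h⟩ := G.exists_dist_eq_diam
    rw [← h, ← dist_iso φ]
    exact dist_le_diam (connected_iff_ediam_ne_top.1 hG')
  · obtain ⟨u, v, h⟩ := G'.exists_dist_eq_diam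
    rw [← h, ← dist_iso φ.symm]
    exact dist_le_diam (connected_iff_ediam_ne_top.1 hG)

theorem mk_span_eq_zero_iff (z w : EJInt) :
    Ideal.Quotient.mk (Ideal.span {z}) w = 0 ↔ ∃ v, w = z * v := by
  rw [Ideal.Quotient.eq_zero_iff_mem, Ideal.mem_span_singleton]; rfl

theorem card_EJGraph_of_iso {c d : ℕ} (φ : frobGraph a ≃g EJGraph ⟨(c : ℤ), (d : ℤ)⟩) :
    c ^ 2 + c * d + d ^ 2 = n := by
  have h : Nat.card (EJInt ⧸ Ideal.span {(⟨(c : ℤ), (d : ℤ)⟩ : EJInt)}) = n := by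
    rw [← Nat.card_congr φ.toEquiv, Nat.card_zmod]
  have hz : (⟨(c : ℤ), (d : ℤ)⟩ : EJInt) ≠ 0 := by
    -- A zero generator would leave the infinite ring `ℤ[ρ]` itself as vertex set.
    intro h0
    rw [h0, Ideal.span_singleton_eq_bot.2 rfl,
      Nat.card_congr (RingEquiv.quotientBot EJInt).toEquiv] at h
    have : Infinite EJInt := Infinite.of_injective (fun m : ℤ => (⟨m, 0⟩ : EJInt)) fun m m' h => by
      simpa using h
    rw [Nat.card_eq_zero_of_infinite] at h
    exact NeZero.ne n h.symm
  rw [card_quotient_span _ hz, norm_mk] at h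
  rw [← h]
  zify
  rw [abs_of_nonneg (by positivity)]

include ha

/-- Any isomorphism serves, not necessarily one induced by a ring map: after translating the image
of `0` back to `0` it preserves the distance distribution, and counting vertices gives the norm. -/
theorem diam_and_formula_of_iso {c d : ℕ} (hdc : d ≤ c) (h3 : n % 3 ≠ 0)
    (φ : frobGraph a ≃g EJGraph ⟨(c : ℤ), (d : ℤ)⟩) :
    (frobGraph a).diam = (2 * c + d) / 3 ∧
    ∀ p : ℚ, 3 * p = ((∑ x, (frobGraph a).dist 0 x : ℕ) : ℚ) → ∀ D : ℕ, D = (frobGraph a).diam →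
      (Odd (c + d) → p = D * (D + 1) * ((2 * c + d) - (2 * D + 1))
          - 1 / 12 * (2 * c - d) * (((c : ℚ) + d) ^ 2 - 1)) ∧
      (Even (c + d) → p = 1 / 2 * D * (D + 1) * ((7 * c + 5 * d) - 2 * (2 * D + 1))
          + 1 / 12 * ((c : ℚ) + d) ^ 2 * (4 * c + d - 6)
          + 1 / 6 * ((c : ℚ) + d) * (n - 3 * c + 3 - 6 * D * (2 * c + d))) := by
  classical
  have hn := card_EJGraph_of_iso φ
  have hc : 0 < c := by
    rcases Nat.eq_zero_or_pos c with rfl | h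
    · obtain rfl : d = 0 := by omega
      exact absurd hn.symm (NeZero.ne n)
    · exact h
  have h3' : (2 * c + d) % 3 ≠ 0 := by
    intro h
    apply h3
    obtain ⟨m, hm⟩ := Nat.dvd_of_mod_eq_zero h
    rw [← hn]
    apply Nat.mod_eq_zero_of_dvd
    -- If 3 divided `2c + d`, substituting `d = 3m - 2c` would make the norm `n` divisible by 3.
    have : ((c ^ 2 + c * d + d ^ 2 : ℕ) : ℤ) = 3 * (3 * m ^ 2 - 3 * m * c + c ^ 2) := by
      have : (d : ℤ) = 3 * m - 2 * c := by push_cast [← Int.natCast_inj] at hm; linarith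
      push_cast; rw [this]; ring
    have h' : (3 : ℤ) ∣ ((c ^ 2 + c * d + d ^ 2 : ℕ) : ℤ) := ⟨_, this⟩
    exact_mod_cast h'
  have : Fintype (EJInt ⧸ Ideal.span {(⟨(c : ℤ), (d : ℤ)⟩ : EJInt)}) :=
    Fintype.ofEquiv _ φ.toEquiv
  rw [EJGraph_eq_hexCayley] at φ
  have hf := Ideal.Quotient.mk_surjective (I := Ideal.span {(⟨(c : ℤ), (d : ℤ)⟩ : EJInt)})
  have hker := mk_span_eq_zero_iff (⟨(c : ℤ), (d : ℤ)⟩ : EJInt)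
  have hcard : Fintype.card (EJInt ⧸ Ideal.span {(⟨(c : ℤ), (d : ℤ)⟩ : EJInt)}) =
      c ^ 2 + c * d + d ^ 2 := by
    rw [← Fintype.card_congr φ.toEquiv, ZMod.card, hn]
  have hdiam : (frobGraph a).diam = (2 * c + d) / 3 := by
    rw [diam_eq_of_iso φ (frobGraph_connected ha) (hexCayley_connected hf),
      diam_eq_of_kernel hf hker hcard hdc hc]
  refine ⟨hdiam, fun p hp D hD => ?_⟩
  have hsum : (∑ x, (frobGraph a).dist 0 x) = ∑ y, (hexCayley
      (Ideal.Quotient.mk (Ideal.span {(⟨(c : ℤ), (d : ℤ)⟩ : EJInt)}))).dist 0 y := by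
    rw [← Equiv.sum_comp (φ.toEquiv.trans (Equiv.subRight (φ 0)))]
    refine Finset.sum_congr rfl fun x _ => ?_
    rw [← dist_iso φ, hexCayley_dist_eq]; rfl
  rw [hsum] at hp
  have := forwarding_formula_of_kernel hf hker hcard hdc hc h3' (hD.trans hdiam) hp
  refine ⟨this.1, fun he => ?_⟩
  rw [this.2 he, ← hn]
  push_cast
  ring

/-- From `3D ≤ 2c + d` one gets `9D² ≤ (2c + d)² < 9(c² + cd + d²) = 9n`. -/
theorem diam_sq_lt (h3 : n % 3 ≠ 0) : (frobGraph a).diam ^ 2 < n := by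
  obtain ⟨c, d, hdc, -, hn, ⟨φ⟩⟩ := exists_iso_EJGraph ha
  rw [(diam_and_formula_of_iso ha hdc h3 φ).1]
  have hc : 0 < c := by
    rcases Nat.eq_zero_or_pos c with rfl | h
    · obtain rfl : d = 0 := by omega
      exact absurd hn.symm (NeZero.ne n)
    · exact h
  have h1 : 3 * ((2 * c + d) / 3) ≤ 2 * c + d := Nat.mul_div_le _ _
  generalize (2 * c + d) / 3 = D at h1
  subst hn
  nlinarith [Nat.mul_le_mul h1 h1]

theorem sum_dist_eq : ∑ u, ∑ v, (frobGraph a).dist u v = n * ∑ x, (frobGraph a).dist 0 x := by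
  have h : ∀ u, ∑ v, (frobGraph a).dist u v = ∑ x, (frobGraph a).dist 0 x := fun u => by
    rw [← Equiv.sum_comp (Equiv.subRight u) fun x => (frobGraph a).dist 0 x]
    exact Finset.sum_congr rfl fun v _ => frobGraph_dist_eq ha u v
  simp [h]

/-- The edge-forwarding index in terms of the distances from a vertex. -/
theorem three_mul_edgeForwardingIndex (hn : 1 < n) (h6 : n.Coprime 6) {R : Routing (frobGraph a)}
    (hs : IsShortestPathRouting R) (hu : IsArcUniform R) (d : (frobGraph a).Dart) :
    3 * edgeForwardingIndex (frobGraph a) = ∑ x, (frobGraph a).dist 0 x := by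
  classical
  have h := card_mul_maxArcLoad hs hu d
  rw [card_dart ha h6 hn, sum_dist_eq ha, mul_assoc] at h
  obtain ⟨h1, h2, -⟩ := forwarding_indices hs hu d
  rw [← Nat.eq_of_mul_eq_mul_left (NeZero.pos n) h, ← h2, h1]
  ring

end Transfer

end FrobeniusCirculant

theorem mainTheorem4 (n : ℕ) [NeZero n] (hn : 7 ≤ n)
    (hprime : ∀ q : ℕ, q.Prime → q ∣ n → q % 6 = 1)
    (a : ZMod n) (ha : a ^ 2 - a + 1 = 0) :
    -- forwarding indices
    (edgeForwardingIndex (frobGraph a) = 2 * arcForwardingIndex (frobGraph a) ∧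
      edgeForwardingIndex (frobGraph a) = 2 * minimalArcForwardingIndex (frobGraph a) ∧
      edgeForwardingIndex (frobGraph a) = minimalEdgeForwardingIndex (frobGraph a)) ∧
    -- the explicit formulas
    (∃ c d : ℕ, d ≤ c ∧ Nat.Coprime c d ∧
      Nonempty (frobGraph a ≃g EJGraph ⟨(c : ℤ), (d : ℤ)⟩)) ∧
    (∀ c d : ℕ, d ≤ c → Nonempty (frobGraph a ≃g EJGraph ⟨(c : ℤ), (d : ℤ)⟩) →
      ∀ D : ℕ, D = (frobGraph a).diam →
      (Odd (c + d) → (edgeForwardingIndex (frobGraph a) : ℚ) =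
        D * (D + 1) * ((2 * c + d) - (2 * D + 1))
          - 1 / 12 * (2 * c - d) * (((c : ℚ) + d) ^ 2 - 1)) ∧
      (Even (c + d) → (edgeForwardingIndex (frobGraph a) : ℚ) =
        1 / 2 * D * (D + 1) * ((7 * c + 5 * d) - 2 * (2 * D + 1))
          + 1 / 12 * ((c : ℚ) + d) ^ 2 * (4 * c + d - 6)
          + 1 / 6 * ((c : ℚ) + d) * (n - 3 * c + 3 - 6 * D * (2 * c + d)))) ∧
    -- the minimum gossip time
    (gossipTime (frobGraph a) : ℚ) = ((n : ℚ) - 1) / 6 ∧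
    -- the trees can be constructed, and whatever choices are made:
    (∃ p, IsParentChoice a p) ∧
    ∀ p : ZMod n → ZMod n, IsParentChoice a p →
      -- the `T_u` are spanning trees of the graph, so that they determine the routing
      (∀ u, treeT a p u ≤ frobGraph a ∧ (treeT a p u).IsTree) ∧
      (∃! P : Routing (frobGraph a), IsTreeRouting a p P) ∧
      -- the routing
      (∀ P : Routing (frobGraph a), IsTreeRouting a p P →
        IsShortestPathRouting P ∧
        IsArcTransitiveRouting (affineGroup a ha) P ∧
        IsEdgeUniform P ∧ IsArcUniform P ∧
        maxEdgeLoad P = edgeForwardingIndex (frobGraph a) ∧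
        maxArcLoad P = arcForwardingIndex (frobGraph a) ∧
        maxArcLoad P = minimalArcForwardingIndex (frobGraph a) ∧
        maxEdgeLoad P = minimalEdgeForwardingIndex (frobGraph a)) ∧
      -- the gossiping algorithm
      (∀ ord : ∀ t, Fin (layerCard a t) ≃ layer a t,
        IsGossipScheme (frobGraph a) (gossipTime (frobGraph a)) (algorithmSend a p ord) ∧
        -- (a)
        (∀ w v, ReachesAlongShortestPath (frobGraph a) (algorithmSend a p ord) w v) ∧
        (∀ s w x y, algorithmSend a p ord s w x y →
          (frobGraph a).dist w y = (frobGraph a).dist w x + 1) ∧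
        -- (b)
        (∀ s w, 1 ≤ s → s ≤ gossipTime (frobGraph a) →
          (arcsUsed (algorithmSend a p ord) s w).ncard = 6) ∧
        (∀ s w, 2 ≤ s → s ≤ gossipTime (frobGraph a) →
          IsArcMatching (arcsUsed (algorithmSend a p ord) s w)) ∧
        -- (c)
        (∀ s, 1 ≤ s → s ≤ gossipTime (frobGraph a) → ∀ x y, (frobGraph a).Adj x y →
          ∃! w, algorithmSend a p ord s w x y)) := by
  classical
  have hn1 : 1 < n := by omega
  have h2 : ¬ 2 ∣ n := fun h => absurd (hprime 2 Nat.prime_two h) (by norm_num)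
  have h3 : ¬ 3 ∣ n := fun h => absurd (hprime 3 Nat.prime_three h) (by norm_num)
  have h6 : n.Coprime 6 := Nat.Coprime.mul_right (n := 3)
    ((Nat.Prime.coprime_iff_not_dvd Nat.prime_two).2 h2).symm
    ((Nat.Prime.coprime_iff_not_dvd Nat.prime_three).2 h3).symm
  have h3' : n % 3 ≠ 0 := fun h => h3 (Nat.dvd_of_mod_eq_zero h)
  have hD := diam_sq_lt ha h3'
  have hY := isTransversal_sectorY ha hn1 hD
  have hcard := ncard_sectorY ha h6 hY
  have hex := exists_isParentChoice ha hn1 hD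
  obtain ⟨p₀, hp₀⟩ := hex
  obtain ⟨P₀, hP₀, hPp₀⟩ := exists_isParentMap ha hn1 h6 hY hp₀
  obtain ⟨R₀, hR₀, -⟩ := existsUnique_treeRouting ha hP₀ hY hPp₀
  let e : (frobGraph a).Dart := ⟨(0, 0 + a ^ 0), (frobGraph_adj ha hn1).2 ⟨0, rfl⟩⟩
  have hs₀ := IsTreeRouting.isShortestPathRouting ha hP₀ hY hPp₀ hR₀
  have hu₀ := (IsTreeRouting.isArcTransitiveRouting ha hP₀ hY hPp₀ hn1 hR₀).isArcUniform
  obtain ⟨i1, i2, i3, i4, i5⟩ := forwarding_indices hs₀ hu₀ e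
  have hπ := three_mul_edgeForwardingIndex ha hn1 h6 hs₀ hu₀ e
  -- Any enumeration will do here: it supplies one optimal scheme, which fixes the value of the
  -- gossip time.
  let ord₀ : ∀ t, Fin (layerCard a t) ≃ layer a t := fun t =>
    (Finite.equivFinOfCardEq (Nat.card_coe_set_eq _)).symm
  obtain ⟨τ₀, hτ₀, -⟩ := exists_schedule ha hY ord₀
  have htime : gossipTime (frobGraph a) = (sectorY a).ncard :=
    gossipTime_eq ha hn1 hP₀ hτ₀ hcard
  refine ⟨⟨?_, ?_, ?_⟩, ?_, ?_, ?_, ⟨p₀, hp₀⟩, ?_⟩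
  · rw [← i2, ← i3, i1]
  · rw [← i2, ← i4, i1]
  · rw [← i2, ← i5]
  · obtain ⟨c, d, hdc, hcop, -, hφ⟩ := exists_iso_EJGraph ha
    exact ⟨c, d, hdc, hcop, hφ⟩
  · rintro c d hdc ⟨φ⟩ D hDd
    exact (diam_and_formula_of_iso ha hdc h3' φ).2 _ (by rw [← hπ]; push_cast; rfl) D hDd
  · rw [htime]
    have hc : (6 * (sectorY a).ncard + 1 : ℚ) = n := by exact_mod_cast hcard
    rw [← hc]; ring
  · intro p hp
    obtain ⟨P, hP, hPp⟩ := exists_isParentMap ha hn1 h6 hY hp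
    refine ⟨fun u => ⟨treeT_le ha hP hY hPp u, treeT_isTree ha hP hY hPp u⟩,
      existsUnique_treeRouting ha hP hY hPp, ?_, ?_⟩
    · intro R hR
      have hs := IsTreeRouting.isShortestPathRouting ha hP hY hPp hR
      have ht := IsTreeRouting.isArcTransitiveRouting ha hP hY hPp hn1 hR
      obtain ⟨-, j2, j3, j4, j5⟩ := forwarding_indices hs ht.isArcUniform e
      exact ⟨hs, ht, ht.isArcUniform.isEdgeUniform, ht.isArcUniform, j2, j3, j4, j5⟩
    · intro ord
      obtain ⟨τ, hτ, hord⟩ := exists_schedule ha hY ord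
      rw [algorithmSend_eq ha hY hP hPp ord hτ hord, htime]
      exact ⟨scheduledSend_isGossipScheme ha hn1 hP hτ, scheduledSend_reaches ha hP hτ,
        scheduledSend_dist ha hP,
        fun s w h1 h2 => ncard_arcsUsed_scheduledSend ha hP hτ h6 h1 h2 w,
        fun s w h1 h2 => isArcMatching_arcsUsed ha hn1 hP hτ h6 h1 h2 w,
        fun s h1 h2 x y h => existsUnique_scheduledSend ha hn1 hP hτ h1 h2 h⟩
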